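/- For $k\in(0,1)$ let $K(k)=\int_0^1\frac{dt}{\sqrt{(1-t^2)(1-k^2t^2)}}$ and let $\mathrm{dn}(\cdot;k)$ be the Jacobi dnoidal function, $\mathrm{dn}(u;k)=\sqrt{1-k^2\sin^2\chi}$ where $\int_0^{\chi}\frac{dt}{\sqrt{1-k^2\sin^2 t}}=u$. Let $L,c>0$ and $\sigma>2\pi^2/L^2$, and let $\phi_0$ be the dnoidal wave of period $L$, $$\phi_0(x)=\eta_1\,\mathrm{dn}\Big(\frac{\eta_1}{2\sqrt c}\,x;k\Big),\qquad 0<\eta_2<\eta_1,\quad \eta_1^2+\eta_2^2=4c\sigma,\quad k^2=\frac{\eta_1^2-\eta_2^2}{\eta_1^2},\quad \frac{4\sqrt c}{\eta_1}K(k)=L .$$ Consider the linear operator $$\mathcal L_0=-\frac{d^2}{dx^2}+\sigma-\frac{3}{2c}\phi_0^2$$ in $L^2_{per}([0,L])$ with domain $H^2_{per}([0,L])$. Its spectrum is a discrete set of real eigenvalues tending to $+\infty$; listing the distinct ones as $\lambda_0<\lambda_1<\lambda_2<\cdots$, the following hold. The first three eigenvalues $\lambda_0,\lambda_1,\lambda_2$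 are simple. The only negative eigenvalue is $\lambda_0$, and $\lambda_1=0$, with eigenspace spanned by $\phi_0'$. All the remaining eigenvalues $\lambda_n$, $n\ge 3$, are double. (Simple and double mean that the eigenspace has dimension one and two, respectively.) -/

import Mathlib

open MeasureTheory Filter Topology
open scoped ENNReal

namespace PeriodicHill

noncomputable section

/-! ### Jacobi elliptic functions and the dnoidal wave -/

/-- The complete elliptic integral of the first kind,
`K(k) = ∫₀¹ dt / √((1 - t²)(1 - k²t²))`. -/
def ellipticK (k : ℝ) : ℝ :=
  ∫ t in (0 : ℝ)..1, 1 / √((1 - t ^ 2) * (1 - k ^ 2 * t ^ 2))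

/-- The incomplete elliptic integral of the first kind in the amplitude,
`F(χ; k) = ∫₀^χ dt / √(1 - k² sin² t)`. -/
def ellipticF (k χ : ℝ) : ℝ :=
  ∫ t in (0 : ℝ)..χ, 1 / √(1 - k ^ 2 * Real.sin t ^ 2)

/-- The Jacobi amplitude: the inverse function of `χ ↦ F(χ; k)`, which is a bijection of `ℝ`
for `0 ≤ k < 1`. -/
def jacobiAm (k u : ℝ) : ℝ := Function.invFun (ellipticF k) u

/-- The Jacobi elliptic function `sn(u; k)`. -/
def jacobiSn (k u : ℝ) : ℝ := Real.sin (jacobiAm k u)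

/-- The Jacobi elliptic function `dn(u; k)`. -/
def jacobiDn (k u : ℝ) : ℝ := √(1 - k ^ 2 * jacobiSn k u ^ 2)

/-- The modulus `k ≥ 0` with `k² = (η₁² - η₂²) / η₁²`. -/
def modulus (η₁ η₂ : ℝ) : ℝ := √((η₁ ^ 2 - η₂ ^ 2) / η₁ ^ 2)

/-- The dnoidal wave `φ₀(x) = η₁ dn(η₁ x / (2√c); k)`. -/
def dnoidal (c η₁ η₂ x : ℝ) : ℝ :=
  η₁ * jacobiDn (modulus η₁ η₂) (η₁ / (2 * √c) * x)

/-! ### Unbounded operators: eigenspaces and spectrum -/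

section Unbounded

variable {H : Type*} [NormedAddCommGroup H] [InnerProductSpace ℂ H]

/-- The eigenspace `{f ∈ D(T) | T f = z f}` of an unbounded operator `T`. -/
def eigenspace (T : H →ₗ.[ℂ] H) (z : ℂ) : Submodule ℂ T.domain :=
  LinearMap.ker (T.toFun - z • T.domain.subtype)

/-- The resolvent set of `T`: those `z` for which `T - z : D(T) → H` has a two-sided inverse
which is a bounded operator on `H`. -/
def resolventSet (T : H →ₗ.[ℂ] H) : Set ℂ :=
  {z | ∃ R : H →L[ℂ] H,
    (∀ y : H, ∃ h : R y ∈ T.domain, T ⟨R y, h⟩ - z • R y = y) ∧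
    ∀ x : T.domain, R (T x - z • (x : H)) = x}

/-- The spectrum of an unbounded operator. -/
def spectrum (T : H →ₗ.[ℂ] H) : Set ℂ := (resolventSet T)ᶜ

end Unbounded

/-! ### The operator `-d²/dx² + V` on `L`-periodic functions -/

section Periodic

variable (L : ℝ) [Fact (0 < L)]

/-- The space `L²_per([0,L])` of complex-valued functions. The measure is the Lebesgue measure of
one period, normalized to total mass one. -/
abbrev L2per : Type := Lp ℂ 2 (AddCircle.haarAddCircle : Measure (AddCircle L))

/-- The periodic Sobolev space `H²_per([0,L])`: all `f` with `∑ₙ (1 + |n|²)² |f̂(n)|² < ∞`. -/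
def H2per : Submodule ℂ (L2per L) where
  carrier := {f | Summable fun n : ℤ => (1 + (n : ℝ) ^ 2) ^ 2 * ‖fourierCoeff f n‖ ^ 2}
  zero_mem' := by
    have h : ∀ n : ℤ, fourierCoeff ((0 : L2per L) : AddCircle L → ℂ) n = 0 := fun n => by
      rw [← fourierBasis_repr, map_zero]; rfl
    simp only [Set.mem_ofPred_eq, h]
    simp
  add_mem' := by
    intro f g hf hg
    simp only [Set.mem_ofPred_eq] at hf hg ⊢
    refine Summable.of_nonneg_of_le (fun n => by positivity) (fun n => ?_)
      ((hf.mul_left 2).add (hg.mul_left 2))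
    have h : fourierCoeff ((f + g : L2per L) : AddCircle L → ℂ) n
        = fourierCoeff f n + fourierCoeff g n := by
      simp only [← fourierBasis_repr, map_add]; rfl
    have h1 : ‖fourierCoeff f n + fourierCoeff g n‖ ^ 2
        ≤ 2 * ‖fourierCoeff f n‖ ^ 2 + 2 * ‖fourierCoeff g n‖ ^ 2 := by
      have h2 := norm_add_le (fourierCoeff f n) (fourierCoeff g n)
      have h3 := norm_nonneg (fourierCoeff f n + fourierCoeff g n)
      nlinarith [sq_nonneg (‖fourierCoeff f n‖ - ‖fourierCoeff g n‖)]
    rw [h]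
    have := mul_le_mul_of_nonneg_left h1 (sq_nonneg (1 + (n : ℝ) ^ 2))
    linarith
  smul_mem' := by
    intro a f hf
    simp only [Set.mem_ofPred_eq] at hf ⊢
    have h : ∀ n, fourierCoeff ((a • f : L2per L) : AddCircle L → ℂ) n
        = a * fourierCoeff f n := fun n => by
      simp only [← fourierBasis_repr, map_smul]; rfl
    refine (hf.mul_left (‖a‖ ^ 2)).congr fun n => ?_
    rw [h, norm_mul]; ring

theorem memlp_secondDeriv (f : H2per L) :
    Memℓp (fun n : ℤ => (((2 * Real.pi * n / L) ^ 2 : ℝ) : ℂ) * fourierCoeff (f : L2per L) n)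
      2 := by
  have hf : Summable fun n : ℤ =>
    (1 + (n : ℝ) ^ 2) ^ 2 * ‖fourierCoeff (f : L2per L) n‖ ^ 2 := f.2
  refine memℓp_gen ?_
  refine Summable.of_nonneg_of_le (fun n => by positivity) (fun n => ?_)
    (hf.mul_left (((2 * Real.pi / L) ^ 2) ^ 2))
  have h1 : ‖(((2 * Real.pi * n / L) ^ 2 : ℝ) : ℂ)‖ = (2 * Real.pi / L) ^ 2 * (n : ℝ) ^ 2 := by
    rw [Complex.norm_real, Real.norm_of_nonneg (by positivity)]; ring
  have h2 : ((n : ℝ) ^ 2) ^ 2 ≤ (1 + (n : ℝ) ^ 2) ^ 2 := by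
    gcongr; linarith
  rw [norm_mul, h1, show (2 : ℝ≥0∞).toReal = ((2 : ℕ) : ℝ) by norm_num, Real.rpow_natCast,
    mul_pow, mul_pow, mul_assoc]
  gcongr

/-- The operator `-d²/dx² : H²_per([0,L]) → L²_per([0,L])`, which multiplies the `n`-th Fourier
coefficient by `(2πn/L)²`. -/
def negSecondDeriv : H2per L →ₗ[ℂ] L2per L where
  toFun f := fourierBasis.repr.symm ⟨_, memlp_secondDeriv L f⟩
  map_add' := by
    intro f g
    rw [← map_add]
    congr 1
    ext n
    change _ * fourierCoeff ((f + g : L2per L) : AddCircle L → ℂ) n =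
      _ * fourierCoeff (f : L2per L) n + _ * fourierCoeff (g : L2per L) n
    simp only [← fourierBasis_repr, map_add]
    exact mul_add _ _ _
  map_smul' := by
    intro a f
    rw [RingHom.id_apply, ← map_smul]
    congr 1
    ext n
    change _ * fourierCoeff ((a • f : L2per L) : AddCircle L → ℂ) n =
      a * (_ * fourierCoeff (f : L2per L) n)
    simp only [← fourierBasis_repr, map_smul]
    exact mul_left_comm _ _ _

variable {L}

theorem memLp_potential (V : C(AddCircle L, ℝ)) (f : L2per L) :
    MemLp (fun x => (V x : ℂ) * f x) 2 (AddCircle.haarAddCircle : Measure (AddCircle L)) := by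
  refine MemLp.of_le_mul (c := ‖V‖) (Lp.memLp f) ?_ (Eventually.of_forall fun x => ?_)
  · exact (Complex.continuous_ofReal.comp V.continuous).aestronglyMeasurable.mul
      (Lp.aestronglyMeasurable f)
  · rw [norm_mul, Complex.norm_real]
    exact mul_le_mul_of_nonneg_right (V.norm_coe_le_norm x) (norm_nonneg _)

/-- Multiplication by the potential `V` on `L²_per([0,L])`. -/
def mulPotential (V : C(AddCircle L, ℝ)) : L2per L →ₗ[ℂ] L2per L where
  toFun f := (memLp_potential V f).toLp _
  map_add' := by
    intro f g
    rw [← MemLp.toLp_add, MemLp.toLp_eq_toLp_iff]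
    filter_upwards [Lp.coeFn_add f g] with x hx
    rw [hx]
    exact mul_add _ _ _
  map_smul' := by
    intro a f
    rw [RingHom.id_apply, ← MemLp.toLp_const_smul, MemLp.toLp_eq_toLp_iff]
    filter_upwards [Lp.coeFn_smul a f] with x hx
    rw [hx]
    exact mul_left_comm _ _ _

/-- The operator `-d²/dx² + V` in `L²_per([0,L])` with domain `H²_per([0,L])`. -/
def hillOperator (V : C(AddCircle L, ℝ)) : L2per L →ₗ.[ℂ] L2per L where
  domain := H2per L
  toFun := negSecondDeriv L + (mulPotential V).comp (H2per L).subtype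

end Periodic

end

end PeriodicHill

namespace PeriodicHill

/-! ### Jacobi elliptic functions -/

/-! After division by `2√c` the wave becomes an even positive `q` with `q'² = (e₁ - q²)(q² - e₂)`,
and the potential becomes `e₁ + e₂ - 6q²`, a two-gap Lamé potential. Three periodic eigenfunctions
are explicit: `q²` minus either root of `3m² - 2(e₁ + e₂)m + e₁e₂`, and `q'`. Their eigenvalues are
`-(e₁ + e₂) ± 2D` and `0`, with `D = edgeRoot e₁ e₂`, and `e₁ + e₂ < 2D` puts `0` strictly between
the other two.

Up to the upper edge `-(e₁ + e₂) + 2D` nothing else occurs (`IsDnoidalProfile.eq_of_le`). The upper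
edge function has two simple zeros per period. Any eigenfunction orthogonal to the two lower ones
can be corrected by these so as to vanish at both zeros; Jacobi's completion of the square
(`integral_mul_nonneg_of_zeros`) then makes the shifted quadratic form nonnegative, whereas the
eigenvalue relations make it nonpositive.

Above that edge every periodic eigenvalue is double (`IsDnoidalProfile.exists_second_solution`). A
polynomial `F` in `q²` satisfies the third-order equation of products of solutions, so `f ↦ F f' -
F' f / 2` maps periodic solutions to periodic solutions. The Wronskian of `f` with its image is a
quadratic form in `(f, f')` whose discriminant is negative there, so the two are independent.

What remains is operator theory: eigenvectors in `H²_per` are classical periodic solutions, by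
Fourier series, and the resolvent is compact, so the spectrum is a discrete infinite set of
eigenvalues that can be enumerated. -/

theorem one_sub_sq_mul_sin_sq_pos {k : ℝ} (hk : k ^ 2 < 1) (t : ℝ) :
    0 < 1 - k ^ 2 * Real.sin t ^ 2 := by
  nlinarith [Real.sin_sq_le_one t, sq_nonneg (Real.sin t), sq_nonneg k]

theorem continuous_ellipticF_integrand {k : ℝ} (hk : k ^ 2 < 1) :
    Continuous fun t : ℝ => 1 / √(1 - k ^ 2 * Real.sin t ^ 2) := by
  refine Continuous.div continuous_const (by fun_prop) fun t => ?_
  exact (Real.sqrt_pos.2 (one_sub_sq_mul_sin_sq_pos hk t)).ne'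

theorem hasDerivAt_ellipticF {k : ℝ} (hk : k ^ 2 < 1) (χ : ℝ) :
    HasDerivAt (ellipticF k) (1 / √(1 - k ^ 2 * Real.sin χ ^ 2)) χ :=
  ((continuous_ellipticF_integrand hk).integral_hasStrictDerivAt 0 χ).hasDerivAt

theorem strictMono_ellipticF {k : ℝ} (hk : k ^ 2 < 1) : StrictMono (ellipticF k) := by
  refine strictMono_of_deriv_pos fun χ => ?_
  rw [(hasDerivAt_ellipticF hk χ).deriv]
  have := Real.sqrt_pos.2 (one_sub_sq_mul_sin_sq_pos hk χ)
  positivity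

@[simp] theorem ellipticF_zero (k : ℝ) : ellipticF k 0 = 0 := by simp [ellipticF]

theorem ellipticF_neg (k χ : ℝ) : ellipticF k (-χ) = -ellipticF k χ := by
  unfold ellipticF
  have h := intervalIntegral.integral_comp_neg (a := 0) (b := χ)
    (fun t => 1 / √(1 - k ^ 2 * Real.sin t ^ 2))
  simp only [Real.sin_neg, neg_sq, neg_zero] at h
  rw [h, intervalIntegral.integral_symm]

/-- The integrand is at least `1`. With oddness this makes `ellipticF k` onto, so that the `invFun`
in `jacobiAm` is a genuine inverse. -/
theorem le_ellipticF {k : ℝ} (hk : k ^ 2 < 1) {χ : ℝ} (hχ : 0 ≤ χ) : χ ≤ ellipticF k χ := by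
  have h : Monotone fun t => ellipticF k t - t := by
    refine monotone_of_deriv_nonneg
      (fun t => ((hasDerivAt_ellipticF hk t).sub (hasDerivAt_id t)).differentiableAt) fun t => ?_
    have hd : HasDerivAt (fun t => ellipticF k t - t) _ t :=
      (hasDerivAt_ellipticF hk t).sub (hasDerivAt_id t)
    rw [hd.deriv, sub_nonneg, le_div_iff₀
      (Real.sqrt_pos.2 (one_sub_sq_mul_sin_sq_pos hk t)), one_mul, Real.sqrt_le_one]
    nlinarith [mul_nonneg (sq_nonneg k) (sq_nonneg (Real.sin t))]
  have := h hχ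
  simp only [ellipticF_zero] at this
  linarith

theorem surjective_ellipticF {k : ℝ} (hk : k ^ 2 < 1) : Function.Surjective (ellipticF k) := by
  have hc : Continuous (ellipticF k) :=
    continuous_iff_continuousAt.2 fun χ => (hasDerivAt_ellipticF hk χ).continuousAt
  refine hc.surjective ?_ ?_
  · exact tendsto_atTop_mono' _ ((eventually_ge_atTop 0).mono fun χ hχ => le_ellipticF hk hχ)
      tendsto_id
  · refine tendsto_atBot_mono' _ ((eventually_le_atBot 0).mono fun χ hχ => ?_) tendsto_id
    have := le_ellipticF hk (neg_nonneg.2 hχ)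
    rw [ellipticF_neg] at this
    simp only [id]; linarith

theorem ellipticF_jacobiAm {k : ℝ} (hk : k ^ 2 < 1) (u : ℝ) : ellipticF k (jacobiAm k u) = u :=
  Function.rightInverse_invFun (surjective_ellipticF hk) u

theorem jacobiAm_ellipticF {k : ℝ} (hk : k ^ 2 < 1) (χ : ℝ) : jacobiAm k (ellipticF k χ) = χ :=
  Function.leftInverse_invFun (strictMono_ellipticF hk).injective χ

theorem strictMono_jacobiAm {k : ℝ} (hk : k ^ 2 < 1) : StrictMono (jacobiAm k) := fun u v h => by
  rw [← (strictMono_ellipticF hk).lt_iff_lt, ellipticF_jacobiAm hk, ellipticF_jacobiAm hk]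
  exact h

theorem continuous_jacobiAm {k : ℝ} (hk : k ^ 2 < 1) : Continuous (jacobiAm k) :=
  (strictMono_jacobiAm hk).monotone.continuous_of_surjective
    fun χ => ⟨_, jacobiAm_ellipticF hk χ⟩

theorem hasDerivAt_jacobiAm {k : ℝ} (hk : k ^ 2 < 1) (u : ℝ) :
    HasDerivAt (jacobiAm k) (jacobiDn k u) u := by
  have h := HasDerivAt.of_local_left_inverse (continuous_jacobiAm hk).continuousAt
    (hasDerivAt_ellipticF hk (jacobiAm k u))
    (one_div_ne_zero (Real.sqrt_pos.2 (one_sub_sq_mul_sin_sq_pos hk _)).ne')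
    (Eventually.of_forall (ellipticF_jacobiAm hk))
  rwa [one_div, inv_inv] at h

theorem jacobiDn_pos {k : ℝ} (hk : k ^ 2 < 1) (u : ℝ) : 0 < jacobiDn k u :=
  Real.sqrt_pos.2 (one_sub_sq_mul_sin_sq_pos hk _)

theorem jacobiDn_sq {k : ℝ} (hk : k ^ 2 < 1) (u : ℝ) :
    jacobiDn k u ^ 2 = 1 - k ^ 2 * Real.sin (jacobiAm k u) ^ 2 :=
  Real.sq_sqrt (one_sub_sq_mul_sin_sq_pos hk _).le

theorem hasDerivAt_jacobiDn {k : ℝ} (hk : k ^ 2 < 1) (u : ℝ) :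
    HasDerivAt (jacobiDn k) (-k ^ 2 * (Real.sin (jacobiAm k u) * Real.cos (jacobiAm k u))) u := by
  have h := ((((hasDerivAt_jacobiAm hk u).sin.pow 2).const_mul (k ^ 2)).const_sub 1).sqrt
    (one_sub_sq_mul_sin_sq_pos hk _).ne'
  have hd := (jacobiDn_pos hk u).ne'
  convert! h using 1
  simp only [Nat.cast_ofNat, Nat.add_one_sub_one, pow_one]
  change _ = -(k ^ 2 * (2 * Real.sin (jacobiAm k u) * (Real.cos (jacobiAm k u) * jacobiDn k u)))
    / (2 * jacobiDn k u)
  field_simp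

/-- The function differentiated is `dn'`, so this is the second-order equation `dn'' = (2 - k²) dn -
2 dn³`. -/
theorem hasDerivAt_sn_mul_cn {k : ℝ} (hk : k ^ 2 < 1) (u : ℝ) :
    HasDerivAt (fun v => -k ^ 2 * (Real.sin (jacobiAm k v) * Real.cos (jacobiAm k v)))
      ((2 - k ^ 2) * jacobiDn k u - 2 * jacobiDn k u ^ 3) u := by
  have h := (((hasDerivAt_jacobiAm hk u).sin.mul (hasDerivAt_jacobiAm hk u).cos)).const_mul
    (-k ^ 2)
  convert! h using 1
  linear_combination (-2 * jacobiDn k u) * jacobiDn_sq hk u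
    + k ^ 2 * jacobiDn k u * Real.sin_sq_add_cos_sq (jacobiAm k u)

theorem jacobiAm_zero {k : ℝ} (hk : k ^ 2 < 1) : jacobiAm k 0 = 0 := by
  simpa using jacobiAm_ellipticF hk 0

theorem jacobiAm_neg {k : ℝ} (hk : k ^ 2 < 1) (u : ℝ) : jacobiAm k (-u) = -jacobiAm k u := by
  apply (strictMono_ellipticF hk).injective
  rw [ellipticF_neg, ellipticF_jacobiAm hk, ellipticF_jacobiAm hk]

/-- Substitution `t = sin x`. The integrand of `ellipticK` is singular at `1`, hence the passage to
open intervals, where `sin` is injective with nonzero derivative. -/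
theorem ellipticF_pi_div_two {k : ℝ} (hk : k ^ 2 < 1) :
    ellipticF k (Real.pi / 2) = ellipticK k := by
  have hpi := Real.pi_pos
  have himg : Real.sin '' Set.Ioo 0 (Real.pi / 2) = Set.Ioo 0 1 := by
    ext y
    constructor
    · rintro ⟨x, ⟨hx0, hx1⟩, rfl⟩
      refine ⟨Real.sin_pos_of_pos_of_lt_pi hx0 (by linarith), ?_⟩
      have h := Real.strictMonoOn_sin (Set.mem_Icc.2 ⟨by linarith, hx1.le⟩)
        (Set.mem_Icc.2 ⟨by linarith, le_rfl⟩) hx1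
      simpa using h
    · rintro ⟨h0, h1⟩
      exact ⟨Real.arcsin y, ⟨Real.arcsin_pos.2 h0, Real.arcsin_lt_pi_div_two.2 h1⟩,
        Real.sin_arcsin (by linarith) h1.le⟩
  have hinj : Set.InjOn Real.sin (Set.Ioo 0 (Real.pi / 2)) :=
    Real.injOn_sin.mono fun x hx => Set.mem_Icc.2 ⟨by linarith [hx.1], hx.2.le⟩
  unfold ellipticF ellipticK
  rw [intervalIntegral.integral_of_le zero_le_one, integral_Ioc_eq_integral_Ioo, ← himg,
    integral_image_eq_integral_abs_deriv_smul measurableSet_Ioo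
      (fun x _ => (Real.hasDerivAt_sin x).hasDerivWithinAt) hinj,
    intervalIntegral.integral_of_le (by positivity), integral_Ioc_eq_integral_Ioo]
  refine setIntegral_congr_fun measurableSet_Ioo fun x hx => ?_
  have hcos : 0 < Real.cos x := Real.cos_pos_of_mem_Ioo ⟨by linarith [hx.1], hx.2⟩
  have hs := Real.sqrt_pos.2 (one_sub_sq_mul_sin_sq_pos hk x)
  have h1 : 1 - Real.sin x ^ 2 = Real.cos x ^ 2 := by
    linarith [Real.sin_sq_add_cos_sq x]
  simp only [smul_eq_mul]
  rw [h1, Real.sqrt_mul (sq_nonneg _), Real.sqrt_sq hcos.le, abs_of_pos hcos]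
  field_simp

theorem ellipticF_pi {k : ℝ} (hk : k ^ 2 < 1) : ellipticF k Real.pi = 2 * ellipticK k := by
  have hi := fun a b => (continuous_ellipticF_integrand hk).intervalIntegrable (μ := volume) a b
  have h := intervalIntegral.integral_add_adjacent_intervals (hi 0 (Real.pi / 2))
    (hi (Real.pi / 2) Real.pi)
  have h2 := intervalIntegral.integral_comp_sub_left (a := 0) (b := Real.pi / 2)
    (fun t => 1 / √(1 - k ^ 2 * Real.sin t ^ 2)) Real.pi
  simp only [Real.sin_pi_sub, sub_zero, sub_half] at h2
  rw [← h2] at h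
  have h3 := ellipticF_pi_div_two hk
  unfold ellipticF at h3 ⊢
  rw [← h, h3]; ring

theorem ellipticF_add_pi {k : ℝ} (hk : k ^ 2 < 1) (χ : ℝ) :
    ellipticF k (χ + Real.pi) = ellipticF k χ + 2 * ellipticK k := by
  have hi := fun a b => (continuous_ellipticF_integrand hk).intervalIntegrable (μ := volume) a b
  have hp : Function.Periodic (fun t : ℝ => 1 / √(1 - k ^ 2 * Real.sin t ^ 2)) Real.pi :=
    fun t => by simp [Real.sin_add_pi]
  have h := hp.intervalIntegral_add_eq χ 0
  rw [← ellipticF_pi hk]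
  unfold ellipticF
  rw [zero_add] at h
  rw [← h, intervalIntegral.integral_add_adjacent_intervals (hi _ _) (hi _ _)]

theorem jacobiAm_add {k : ℝ} (hk : k ^ 2 < 1) (u : ℝ) :
    jacobiAm k (u + 2 * ellipticK k) = jacobiAm k u + Real.pi := by
  apply (strictMono_ellipticF hk).injective
  rw [ellipticF_add_pi hk, ellipticF_jacobiAm hk, ellipticF_jacobiAm hk]

theorem jacobiAm_ellipticK {k : ℝ} (hk : k ^ 2 < 1) : jacobiAm k (ellipticK k) = Real.pi / 2 := by
  rw [← ellipticF_pi_div_two hk, jacobiAm_ellipticF hk]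

theorem jacobiDn_add {k : ℝ} (hk : k ^ 2 < 1) (u : ℝ) :
    jacobiDn k (u + 2 * ellipticK k) = jacobiDn k u := by
  simp [jacobiDn, jacobiSn, jacobiAm_add hk, Real.sin_add_pi]

theorem jacobiDn_neg {k : ℝ} (hk : k ^ 2 < 1) (u : ℝ) : jacobiDn k (-u) = jacobiDn k u := by
  simp [jacobiDn, jacobiSn, jacobiAm_neg hk]

theorem strictAntiOn_jacobiDn {k : ℝ} (hk : k ^ 2 < 1) (hk0 : k ≠ 0) :
    StrictAntiOn (jacobiDn k) (Set.Icc 0 (ellipticK k)) := by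
  intro u hu v hv huv
  have hpi := Real.pi_pos
  have hu0 : 0 ≤ jacobiAm k u := by
    rw [← jacobiAm_zero hk]; exact (strictMono_jacobiAm hk).monotone hu.1
  have hv1 : jacobiAm k v ≤ Real.pi / 2 := by
    rw [← jacobiAm_ellipticK hk]; exact (strictMono_jacobiAm hk).monotone hv.2
  have hlt := strictMono_jacobiAm hk huv
  have h1 : Real.sin (jacobiAm k u) < Real.sin (jacobiAm k v) :=
    Real.strictMonoOn_sin ⟨by linarith, by linarith⟩ ⟨by linarith, hv1⟩ hlt
  have h0 : 0 ≤ Real.sin (jacobiAm k u) := Real.sin_nonneg_of_nonneg_of_le_pi hu0 (by linarith)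
  refine Real.sqrt_lt_sqrt (one_sub_sq_mul_sin_sq_pos hk _).le ?_
  have : 0 < k ^ 2 := by positivity
  have h2 : Real.sin (jacobiAm k u) ^ 2 < Real.sin (jacobiAm k v) ^ 2 := by gcongr
  have := mul_lt_mul_of_pos_left h2 this
  simp only [jacobiSn]
  linarith

/-! ### The normalized dnoidal profile -/

/-- `q` is an even positive solution of `q'² = (e₁ - q²)(q² - e₂)` of period `L`, decreasing from
`√e₁` to `√e₂` on half a period. -/
structure IsDnoidalProfile (L e₁ e₂ : ℝ) (q q' : ℝ → ℝ) : Prop where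
  period_pos : 0 < L
  e₂_pos : 0 < e₂
  lt : e₂ < e₁
  periodic : Function.Periodic q L
  even : ∀ x, q (-x) = q x
  pos : ∀ x, 0 < q x
  hasDerivAt : ∀ x, HasDerivAt q (q' x) x
  deriv_sq : ∀ x, q' x ^ 2 = (e₁ - q x ^ 2) * (q x ^ 2 - e₂)
  hasDerivAt_deriv : ∀ x, HasDerivAt q' ((e₁ + e₂) * q x - 2 * q x ^ 3) x
  strictAntiOn : StrictAntiOn q (Set.Icc 0 (L / 2))
  sq_zero : q 0 ^ 2 = e₁
  sq_half : q (L / 2) ^ 2 = e₂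

theorem isDnoidalProfile_dn {k a : ℝ} (hk : k ^ 2 < 1) (hk0 : k ≠ 0) (ha : 0 < a)
    (hK : 0 < ellipticK k) :
    IsDnoidalProfile (2 * ellipticK k / a) (a ^ 2) (a ^ 2 * (1 - k ^ 2))
      (fun x => a * jacobiDn k (a * x))
      (fun x => a ^ 2 *
        (-k ^ 2 * (Real.sin (jacobiAm k (a * x)) * Real.cos (jacobiAm k (a * x))))) where
  period_pos := by positivity
  e₂_pos := mul_pos (by positivity) (by linarith)
  lt := by
    have : 0 < a ^ 2 * k ^ 2 := by positivity
    linarith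
  periodic x := by
    simp only
    rw [show a * (x + 2 * ellipticK k / a) = a * x + 2 * ellipticK k by field_simp,
      jacobiDn_add hk]
  even x := by simp only [mul_neg, jacobiDn_neg hk]
  pos x := mul_pos ha (jacobiDn_pos hk _)
  hasDerivAt x := by
    have h := ((hasDerivAt_jacobiDn hk (a * x)).comp x ((hasDerivAt_id x).const_mul a)).const_mul a
    convert! h using 1
    simp only [mul_one]; ring
  deriv_sq x := by
    have h1 := jacobiDn_sq hk (a * x)
    have h2 : Real.cos (jacobiAm k (a * x)) ^ 2 = 1 - Real.sin (jacobiAm k (a * x)) ^ 2 := by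
      linarith [Real.sin_sq_add_cos_sq (jacobiAm k (a * x))]
    simp only [mul_pow]
    rw [h1, h2]; ring
  hasDerivAt_deriv x := by
    have h := ((hasDerivAt_sn_mul_cn hk (a * x)).comp x
      ((hasDerivAt_id x).const_mul a)).const_mul (a ^ 2)
    convert! h using 1
    simp only [mul_one]; ring
  strictAntiOn := by
    intro x hx y hy hxy
    refine mul_lt_mul_of_pos_left (strictAntiOn_jacobiDn hk hk0 ⟨?_, ?_⟩ ⟨?_, ?_⟩ ?_) ha
    · exact mul_nonneg ha.le hx.1
    · have := mul_le_mul_of_nonneg_left hx.2 ha.le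
      rwa [show a * (2 * ellipticK k / a / 2) = ellipticK k by field_simp] at this
    · exact mul_nonneg ha.le hy.1
    · have := mul_le_mul_of_nonneg_left hy.2 ha.le
      rwa [show a * (2 * ellipticK k / a / 2) = ellipticK k by field_simp] at this
    · exact mul_lt_mul_of_pos_left hxy ha
  sq_zero := by
    simp only [mul_pow, mul_zero]
    rw [jacobiDn_sq hk, jacobiAm_zero hk]; simp
  sq_half := by
    simp only [mul_pow]
    rw [show a * (2 * ellipticK k / a / 2) = ellipticK k by field_simp, jacobiDn_sq hk,
      jacobiAm_ellipticK hk]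
    simp

/-! ### Periodic solutions of `y'' = (V - λ) y` -/

section Solutions

variable {E : Type*} [NormedAddCommGroup E] [NormedSpace ℝ E]

/-- `y` is an `L`-periodic classical solution of `-y'' + V y = lam y` with derivative `y'`. -/
structure IsPeriodicSolution (L : ℝ) (V : ℝ → ℝ) (lam : ℝ) (y y' : ℝ → E) : Prop where
  periodic : Function.Periodic y L
  hasDerivAt : ∀ x, HasDerivAt y (y' x) x
  hasDerivAt_deriv : ∀ x, HasDerivAt y' ((V x - lam) • y x) x

namespace IsPeriodicSolution

variable {L : ℝ} {V : ℝ → ℝ} {lam mu : ℝ} {y y' w w' : ℝ → E}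

theorem continuous (h : IsPeriodicSolution L V lam y y') : Continuous y :=
  continuous_iff_continuousAt.2 fun x => (h.hasDerivAt x).continuousAt

theorem continuous_deriv (h : IsPeriodicSolution L V lam y y') : Continuous y' :=
  continuous_iff_continuousAt.2 fun x => (h.hasDerivAt_deriv x).continuousAt

theorem periodic_deriv (h : IsPeriodicSolution L V lam y y') : Function.Periodic y' L := by
  intro x
  have h1 := (h.hasDerivAt (x + L)).comp_add_const x L
  have h2 : (fun x => y (x + L)) = y := funext h.periodic
  rw [h2] at h1
  exact h1.unique (h.hasDerivAt x)

theorem add (h : IsPeriodicSolution L V lam y y') (k : IsPeriodicSolution L V lam w w') :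
    IsPeriodicSolution L V lam (fun x => y x + w x) fun x => y' x + w' x where
  periodic x := by simp only [h.periodic x, k.periodic x]
  hasDerivAt x := (h.hasDerivAt x).add (k.hasDerivAt x)
  hasDerivAt_deriv x := by
    rw [smul_add]; exact (h.hasDerivAt_deriv x).add (k.hasDerivAt_deriv x)

theorem map {F : Type*} [NormedAddCommGroup F] [NormedSpace ℝ F] (T : E →L[ℝ] F)
    (h : IsPeriodicSolution L V lam y y') :
    IsPeriodicSolution L V lam (fun x => T (y x)) fun x => T (y' x) where
  periodic x := by simp only [h.periodic x]
  hasDerivAt x := T.hasFDerivAt.comp_hasDerivAt x (h.hasDerivAt x)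
  hasDerivAt_deriv x := by
    rw [← map_smul]; exact T.hasFDerivAt.comp_hasDerivAt x (h.hasDerivAt_deriv x)

theorem const_smul {𝕜 : Type*} [RCLike 𝕜] [NormedSpace 𝕜 E] [SMulCommClass ℝ 𝕜 E] (a : 𝕜)
    (h : IsPeriodicSolution L V lam y y') :
    IsPeriodicSolution L V lam (fun x => a • y x) fun x => a • y' x where
  periodic x := by simp only [h.periodic x]
  hasDerivAt x := (h.hasDerivAt x).const_smul a
  hasDerivAt_deriv x := by
    rw [smul_comm]; exact (h.hasDerivAt_deriv x).const_smul a

/-- Uniqueness for the first-order system satisfied by `(y, y')`, whose right-hand side is Lipschitz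
uniformly in time because `V` is bounded. -/
theorem eq_zero (h : IsPeriodicSolution L V lam y y') {C : ℝ} (hV : ∀ x, |V x| ≤ C) {x₀ : ℝ}
    (h0 : y x₀ = 0) (h1 : y' x₀ = 0) (x : ℝ) : y x = 0 := by
  have hC : 0 ≤ C := (abs_nonneg _).trans (hV 0)
  let K : NNReal := ⟨1 + C + |lam|, by positivity⟩
  have hv : ∀ t, LipschitzOnWith K (fun p : E × E => (p.2, (V t - lam) • p.1)) Set.univ := by
    intro t
    refine LipschitzOnWith.of_dist_le_mul fun p _ r _ => ?_
    have hK : (K : ℝ) = 1 + C + |lam| := rfl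
    have h1 : |V t - lam| ≤ C + |lam| := (abs_sub _ _).trans (by linarith [hV t])
    rw [Prod.dist_eq, Prod.dist_eq, hK]
    have d1 := dist_nonneg (x := p.1) (y := r.1)
    have d2 := dist_nonneg (x := p.2) (y := r.2)
    have m1 := le_max_left (dist p.1 r.1) (dist p.2 r.2)
    have m2 := le_max_right (dist p.1 r.1) (dist p.2 r.2)
    refine max_le ?_ ?_
    · nlinarith [abs_nonneg lam]
    · rw [dist_smul₀, Real.norm_eq_abs]
      calc |V t - lam| * dist p.1 r.1 ≤ (C + |lam|) * max (dist p.1 r.1) (dist p.2 r.2) := by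
            gcongr
        _ ≤ _ := by nlinarith
  have := ODE_solution_unique_univ (f := fun t => (y t, y' t)) (g := fun _ => ((0 : E), (0 : E)))
    (t₀ := x₀) hv (fun t => ⟨(h.hasDerivAt t).prodMk (h.hasDerivAt_deriv t), trivial⟩)
    (fun t => ⟨by
      simp only [smul_zero]
      exact hasDerivAt_const t _, trivial⟩) (by simp [h0, h1])
  exact congrArg Prod.fst (congrFun this x)

end IsPeriodicSolution

end Solutions

section Real

variable {L : ℝ} {V : ℝ → ℝ} {lam mu : ℝ} {y y' w w' : ℝ → ℝ}

/-- Two real solutions with nonvanishing Wronskian at one point span the space of solutions with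
values in any real vector space. -/
theorem IsPeriodicSolution.eq_combination {E : Type*} [NormedAddCommGroup E] [NormedSpace ℝ E]
    {f f' : ℝ → E} (hf : IsPeriodicSolution L V lam f f') (hy : IsPeriodicSolution L V lam y y')
    (hw : IsPeriodicSolution L V lam w w') {C : ℝ} (hV : ∀ x, |V x| ≤ C) {x₀ : ℝ}
    (hW : y x₀ * w' x₀ - y' x₀ * w x₀ ≠ 0) :
    ∃ a b : E, ∀ x, f x = y x • a + w x • b := by
  set W := y x₀ * w' x₀ - y' x₀ * w x₀ with hWd
  -- Cramer's rule: with these vectors `y • a + w • b` has the same value and derivative as `f` at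
  -- `x₀`.
  let a : E := W⁻¹ • (w' x₀ • f x₀ - w x₀ • f' x₀)
  let b : E := W⁻¹ • (y x₀ • f' x₀ - y' x₀ • f x₀)
  refine ⟨a, b, fun x => ?_⟩
  have h := (hf.add ((hy.map ((ContinuousLinearMap.id ℝ ℝ).smulRight (-a))).add
    (hw.map ((ContinuousLinearMap.id ℝ ℝ).smulRight (-b))))).eq_zero hV (x₀ := x₀) ?_ ?_ x
  · simp only [ContinuousLinearMap.smulRight_apply, ContinuousLinearMap.id_apply, smul_neg] at h
    rw [← sub_eq_zero, ← h]; abel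
  · have : f x₀ = (W⁻¹ * W) • f x₀ := by rw [inv_mul_cancel₀ hW, one_smul]
    simp only [ContinuousLinearMap.smulRight_apply, ContinuousLinearMap.id_apply, a, b]
    nth_rewrite 1 [this]
    rw [hWd]
    module
  · have : f' x₀ = (W⁻¹ * W) • f' x₀ := by rw [inv_mul_cancel₀ hW, one_smul]
    simp only [ContinuousLinearMap.smulRight_apply, ContinuousLinearMap.id_apply, a, b]
    nth_rewrite 1 [this]
    rw [hWd]
    module

/-- Solutions for different values of the spectral parameter are orthogonal. -/
theorem IsPeriodicSolution.integral_mul_eq_zero (hy : IsPeriodicSolution L V lam y y')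
    (hw : IsPeriodicSolution L V mu w w') (hne : lam ≠ mu) (a : ℝ) :
    ∫ x in a..(a + L), y x * w x = 0 := by
  -- The Wronskian has derivative `(lam - mu) y w`, and its increment over a period is zero.
  have hd : ∀ x, HasDerivAt (fun x => y x * w' x - y' x * w x) ((lam - mu) * (y x * w x)) x := by
    intro x
    have h := ((hy.hasDerivAt x).mul (hw.hasDerivAt_deriv x)).sub
      ((hy.hasDerivAt_deriv x).mul (hw.hasDerivAt x))
    convert! h using 1
    simp only [smul_eq_mul]; ring
  have hi : IntervalIntegrable (fun x => (lam - mu) * (y x * w x)) volume a (a + L) :=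
    (((hy.continuous.mul hw.continuous).const_mul _)).intervalIntegrable _ _
  have h := intervalIntegral.integral_eq_sub_of_hasDerivAt (fun x _ => hd x) hi
  rw [intervalIntegral.integral_const_mul, hy.periodic, hw.periodic, hy.periodic_deriv,
    hw.periodic_deriv, sub_self] at h
  exact (mul_eq_zero.1 h).resolve_left (sub_ne_zero.2 hne)

theorem eq_zero_of_integral_sq_le_zero {f : ℝ → ℝ} (hf : Continuous f)
    (hp : Function.Periodic f L) (hL : 0 < L) {a : ℝ} (h : ∫ x in a..(a + L), f x * f x ≤ 0)
    (x : ℝ) : f x = 0 := by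
  by_contra hx
  obtain ⟨y, hy, hxy⟩ := hp.exists_mem_Ico hL x a
  rw [hxy] at hx
  have h2 : 0 < ∫ x in a..(a + L), f x * f x := by
    refine intervalIntegral.integral_pos (by linarith) (hf.mul hf).continuousOn
      (fun _ _ => mul_self_nonneg _) ⟨y, ⟨hy.1, hy.2.le⟩, ?_⟩
    exact mul_self_pos.2 hx
  linarith

/-- Positivity of the quadratic form `∫ (-g'' + (V - mu) g) g` for functions vanishing at two
consecutive simple zeros of a solution `y` of `y'' = (V - mu) y`. -/
theorem integral_mul_nonneg_of_zeros {a b : ℝ} (hab : a < b) {g g' g'' : ℝ → ℝ}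
    (hy : ∀ x, HasDerivAt y (y' x) x) (hy' : ∀ x, HasDerivAt y' ((V x - mu) * y x) x)
    (hg : ∀ x, HasDerivAt g (g' x) x) (hg' : ∀ x, HasDerivAt g' (g'' x) x)
    (hg'' : Continuous g'') (hV : Continuous V)
    (hya : y a = 0) (hyb : y b = 0) (hya' : y' a ≠ 0) (hyb' : y' b ≠ 0)
    (hne : ∀ x ∈ Set.Ioo a b, y x ≠ 0) (hga : g a = 0) (hgb : g b = 0) :
    0 ≤ ∫ x in a..b, (-g'' x + (V x - mu) * g x) * g x := by
  have cg : Continuous g := continuous_iff_continuousAt.2 fun x => (hg x).continuousAt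
  have cg' : Continuous g' := continuous_iff_continuousAt.2 fun x => (hg' x).continuousAt
  have cy' : Continuous y' := continuous_iff_continuousAt.2 fun x => (hy' x).continuousAt
  have cI : Continuous fun x => (-g'' x + (V x - mu) * g x) * g x := by fun_prop
  -- Jacobi's trick: the integrand is `R'` plus the square `(g' - g y' / y)²`, so `S` is monotone.
  -- At the endpoints `g / y` has a finite limit because the zeros of `y` are simple, so `R` is
  -- continuous there with value `0`.
  let R : ℝ → ℝ := fun x => g x * (g x / y x) * y' x - g x * g' x
  let S : ℝ → ℝ := fun x => (∫ t in a..x, (-g'' t + (V t - mu) * g t) * g t) - R x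
  have hend : ∀ c, y c = 0 → y' c ≠ 0 → g c = 0 → ContinuousAt R c := by
    intro c hyc hyc' hgc
    have hq : Tendsto (fun x => g x / y x) (𝓝[≠] c) (𝓝 (g' c / y' c)) := by
      have h := ((hasDerivAt_iff_tendsto_slope.1 (hg c)).div
        (hasDerivAt_iff_tendsto_slope.1 (hy c)) hyc')
      refine h.congr' ?_
      filter_upwards [self_mem_nhdsWithin] with x hx
      have hx : x - c ≠ 0 := sub_ne_zero.2 hx
      rw [Pi.div_apply, slope_def_field, slope_def_field, hyc, hgc, sub_zero, sub_zero,
        div_div_div_cancel_right₀ hx]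
    have hgt : Tendsto g (𝓝[≠] c) (𝓝 0) := by
      rw [← hgc]; exact cg.continuousAt.tendsto.mono_left nhdsWithin_le_nhds
    have hyt := cy'.continuousAt.tendsto.mono_left (nhdsWithin_le_nhds (a := c) (s := {c}ᶜ))
    have hgt' := cg'.continuousAt.tendsto.mono_left (nhdsWithin_le_nhds (a := c) (s := {c}ᶜ))
    have := ((hgt.mul hq).mul hyt).sub (hgt.mul hgt')
    rw [← continuousWithinAt_compl_self, ContinuousWithinAt]
    simpa [R, hgc] using this
  have hRd : ∀ x ∈ Set.Ioo a b, HasDerivAt R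
      ((-g'' x + (V x - mu) * g x) * g x - (g' x - g x * y' x / y x) ^ 2) x := by
    intro x hx
    have hyx := hne x hx
    have h := (((hg x).mul ((hg x).div (hy x) hyx)).mul (hy' x)).sub ((hg x).mul (hg' x))
    convert! h using 1
    simp only [Pi.mul_apply, Pi.div_apply]
    field_simp
    ring
  have hId : ∀ x, HasDerivAt (fun x => ∫ t in a..x, (-g'' t + (V t - mu) * g t) * g t)
      ((-g'' x + (V x - mu) * g x) * g x) x :=
    fun x => (cI.integral_hasStrictDerivAt a x).hasDerivAt
  have hSd : ∀ x ∈ Set.Ioo a b, HasDerivAt S ((g' x - g x * y' x / y x) ^ 2) x := by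
    intro x hx
    have h := (hId x).sub (hRd x hx)
    rwa [sub_sub_cancel] at h
  have hSc : ContinuousOn S (Set.Icc a b) := by
    refine continuousOn_of_forall_continuousAt fun x hx => ?_
    refine (hId x).continuousAt.sub ?_
    rcases eq_or_lt_of_le hx.1 with rfl | h1
    · exact hend _ hya hya' hga
    rcases eq_or_lt_of_le hx.2 with rfl | h2
    · exact hend _ hyb hyb' hgb
    exact (hRd x ⟨h1, h2⟩).continuousAt
  have hmono : MonotoneOn S (Set.Icc a b) := by
    refine monotoneOn_of_deriv_nonneg (convex_Icc a b) hSc ?_ ?_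
    · rw [interior_Icc]
      exact fun x hx => (hSd x hx).differentiableAt.differentiableWithinAt
    · rw [interior_Icc]
      intro x hx
      rw [(hSd x hx).deriv]
      positivity
  have h := hmono (Set.left_mem_Icc.2 hab.le) (Set.right_mem_Icc.2 hab.le) hab.le
  simpa [S, R, hga, hgb] using h

end Real

/-! ### The band edges of the dnoidal potential -/

/-- The potential `e₁ + e₂ - 6 q²` attached to a dnoidal profile. -/
def profilePotential (e₁ e₂ : ℝ) (q : ℝ → ℝ) (x : ℝ) : ℝ := e₁ + e₂ - 6 * q x ^ 2

/-- The square root `√((e₁ + e₂)² - 3 e₁ e₂)`. -/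
noncomputable def edgeRoot (e₁ e₂ : ℝ) : ℝ := √((e₁ + e₂) ^ 2 - 3 * (e₁ * e₂))

theorem edgeRoot_sq (e₁ e₂ : ℝ) : edgeRoot e₁ e₂ ^ 2 = (e₁ + e₂) ^ 2 - 3 * (e₁ * e₂) :=
  Real.sq_sqrt (by nlinarith [sq_nonneg (e₁ - e₂ / 2), sq_nonneg e₂])

namespace IsDnoidalProfile

variable {L e₁ e₂ : ℝ} {q q' : ℝ → ℝ} (h : IsDnoidalProfile L e₁ e₂ q q')
include h

theorem continuous : Continuous q :=
  continuous_iff_continuousAt.2 fun x => (h.hasDerivAt x).continuousAt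

theorem continuous_deriv : Continuous q' :=
  continuous_iff_continuousAt.2 fun x => (h.hasDerivAt_deriv x).continuousAt

theorem e₁_pos : 0 < e₁ := h.e₂_pos.trans h.lt

theorem sq_mem (x : ℝ) : e₂ ≤ q x ^ 2 ∧ q x ^ 2 ≤ e₁ := by
  have h1 := h.deriv_sq x
  have h2 := sq_nonneg (q' x)
  have h3 := h.lt
  constructor <;> nlinarith

theorem abs_potential_le (x : ℝ) : |profilePotential e₁ e₂ q x| ≤ 7 * e₁ := by
  have h1 := h.sq_mem x
  have h2 := h.lt
  have h3 := h.e₂_pos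
  rw [profilePotential, abs_le]
  constructor <;> linarith [h1.1, h1.2]

theorem continuous_potential : Continuous (profilePotential e₁ e₂ q) := by
  have := h.continuous
  unfold profilePotential
  fun_prop

theorem edgeRoot_pos : 0 < edgeRoot e₁ e₂ :=
  Real.sqrt_pos.2 (by nlinarith [h.lt, h.e₂_pos, mul_pos h.e₁_pos h.e₂_pos])

theorem lt_two_mul_edgeRoot : e₁ + e₂ < 2 * edgeRoot e₁ e₂ := by
  have h1 := edgeRoot_sq e₁ e₂
  have h2 := h.edgeRoot_pos
  have h3 : 0 < (e₁ - e₂) ^ 2 := pow_pos (sub_pos.2 h.lt) 2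
  nlinarith

/-- The polynomial `3m² - 2(e₁ + e₂)m + e₁e₂` takes the value `-e₂(e₁ - e₂) < 0` at `e₂`, which
therefore lies between its roots. Hence the lower edge function has no zeros. -/
theorem lower_lt : (e₁ + e₂ - edgeRoot e₁ e₂) / 3 < e₂ := by
  have h1 := edgeRoot_sq e₁ e₂
  have h2 := h.edgeRoot_pos
  have := mul_pos h.e₂_pos (sub_pos.2 h.lt)
  by_contra hc
  have h3 : edgeRoot e₁ e₂ ≤ e₁ - 2 * e₂ := by linarith
  nlinarith

theorem lt_upper : e₂ < (e₁ + e₂ + edgeRoot e₁ e₂) / 3 := by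
  have h1 := edgeRoot_sq e₁ e₂
  have h2 := h.edgeRoot_pos
  have := mul_pos h.e₂_pos (sub_pos.2 h.lt)
  have h4 := h.lt_two_mul_edgeRoot
  have h5 := h.lt
  by_contra hc
  linarith

/-- Together with `lt_upper`, the larger root is interior to the range of `q²`, so the upper edge
function changes sign. -/
theorem upper_lt : (e₁ + e₂ + edgeRoot e₁ e₂) / 3 < e₁ := by
  have h1 := edgeRoot_sq e₁ e₂
  have h2 := h.edgeRoot_pos
  have := mul_pos h.e₁_pos (sub_pos.2 h.lt)
  have h5 := h.lt
  have h6 := h.e₂_pos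
  by_contra hc
  have h3 : 2 * e₁ - e₂ ≤ edgeRoot e₁ e₂ := by linarith
  nlinarith

/-- With `s = q²` one has `s'' = -6s² + 4(e₁ + e₂)s - 2e₁e₂`. Comparing with `(V - lam)(s - m)`, the
`s²` terms agree, the linear terms fix `lam`, and the constant terms give the quadratic equation for
`m`. -/
theorem isPeriodicSolution_sq_sub {m : ℝ} (hm : 3 * m ^ 2 - 2 * (e₁ + e₂) * m + e₁ * e₂ = 0) :
    IsPeriodicSolution L (profilePotential e₁ e₂ q) (6 * m - 3 * (e₁ + e₂))
      (fun x => q x ^ 2 - m) fun x => 2 * (q x * q' x) where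
  periodic x := by simp only [h.periodic x]
  hasDerivAt x := by
    have := ((h.hasDerivAt x).pow 2).sub_const m
    convert! this using 1
    simp only [Nat.cast_ofNat, Nat.add_one_sub_one, pow_one]; ring
  hasDerivAt_deriv x := by
    have := ((h.hasDerivAt x).mul (h.hasDerivAt_deriv x)).const_mul 2
    convert! this using 1
    rw [profilePotential, smul_eq_mul]
    linear_combination (-2) * h.deriv_sq x + 2 * hm

theorem periodic_deriv : Function.Periodic q' L := by
  intro x
  have h1 := (h.hasDerivAt (x + L)).comp_add_const x L
  rw [show (fun x => q (x + L)) = q from funext h.periodic] at h1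
  exact h1.unique (h.hasDerivAt x)

theorem isPeriodicSolution_deriv :
    IsPeriodicSolution L (profilePotential e₁ e₂ q) 0 q' fun x =>
      (e₁ + e₂) * q x - 2 * q x ^ 3 where
  periodic := h.periodic_deriv
  hasDerivAt := h.hasDerivAt_deriv
  hasDerivAt_deriv x := by
    have := ((h.hasDerivAt x).const_mul (e₁ + e₂)).sub (((h.hasDerivAt x).pow 3).const_mul 2)
    convert! this using 1
    rw [profilePotential, smul_eq_mul]
    ring

theorem isPeriodicSolution_lower :
    IsPeriodicSolution L (profilePotential e₁ e₂ q) (-(e₁ + e₂) - 2 * edgeRoot e₁ e₂)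
      (fun x => q x ^ 2 - (e₁ + e₂ - edgeRoot e₁ e₂) / 3) fun x => 2 * (q x * q' x) := by
  have := h.isPeriodicSolution_sq_sub (m := (e₁ + e₂ - edgeRoot e₁ e₂) / 3)
    (by linear_combination edgeRoot_sq e₁ e₂ / 3)
  rwa [show 6 * ((e₁ + e₂ - edgeRoot e₁ e₂) / 3) - 3 * (e₁ + e₂)
    = -(e₁ + e₂) - 2 * edgeRoot e₁ e₂ by ring] at this

theorem isPeriodicSolution_upper :
    IsPeriodicSolution L (profilePotential e₁ e₂ q) (-(e₁ + e₂) + 2 * edgeRoot e₁ e₂)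
      (fun x => q x ^ 2 - (e₁ + e₂ + edgeRoot e₁ e₂) / 3) fun x => 2 * (q x * q' x) := by
  have := h.isPeriodicSolution_sq_sub (m := (e₁ + e₂ + edgeRoot e₁ e₂) / 3)
    (by linear_combination edgeRoot_sq e₁ e₂ / 3)
  rwa [show 6 * ((e₁ + e₂ + edgeRoot e₁ e₂) / 3) - 3 * (e₁ + e₂)
    = -(e₁ + e₂) + 2 * edgeRoot e₁ e₂ by ring] at this

theorem deriv_neg (x : ℝ) : q' (-x) = -q' x := by
  have h1 := (h.hasDerivAt (-x)).comp x (hasDerivAt_neg x)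
  rw [show q ∘ Neg.neg = q from funext h.even] at h1
  have := h1.unique (h.hasDerivAt x)
  linarith

theorem deriv_ne_zero {x : ℝ} (h2 : e₂ < q x ^ 2) (h1 : q x ^ 2 < e₁) : q' x ≠ 0 := by
  intro h0
  have := h.deriv_sq x
  rw [h0] at this
  nlinarith [mul_pos (sub_pos.2 h1) (sub_pos.2 h2)]

theorem lt_of_abs_lt {x z : ℝ} (hz : z ∈ Set.Ioo 0 (L / 2)) (hx : x ∈ Set.Ioo (-z) z) :
    q z < q x := by
  have h1 : |x| < z := abs_lt.2 hx
  have h2 : q |x| = q x := by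
    rcases abs_choice x with h | h' <;> rw [‹|x| = _›]
    exact h.even x
  rw [← h2]
  exact h.strictAntiOn ⟨abs_nonneg x, by linarith [hz.2]⟩ ⟨hz.1.le, hz.2.le⟩ h1

theorem reflect (x : ℝ) : q (L - x) = q x := by
  rw [← h.even, neg_sub, ← h.periodic, sub_add_cancel]

theorem lt_of_mem_Ioo {x z : ℝ} (hz : z ∈ Set.Ioo 0 (L / 2)) (hx : x ∈ Set.Ioo z (-z + L)) :
    q x < q z := by
  rcases le_total x (L / 2) with hxL | hxL
  · exact h.strictAntiOn ⟨hz.1.le, hz.2.le⟩ ⟨hz.1.le.trans hx.1.le, hxL⟩ hx.1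
  · rw [← h.reflect x]
    exact h.strictAntiOn ⟨hz.1.le, hz.2.le⟩ ⟨by linarith [hx.2, hz.1], by linarith⟩
      (by linarith [hx.2])

theorem exists_sq_eq {m : ℝ} (h2 : e₂ < m) (h1 : m < e₁)  :
    ∃ z ∈ Set.Ioo 0 (L / 2), q z ^ 2 = m := by
  have hL := h.period_pos
  have := intermediate_value_Ioo' (by positivity : (0 : ℝ) ≤ L / 2)
    (f := fun x => q x ^ 2) (h.continuous.pow 2).continuousOn
  simp only [h.sq_zero, h.sq_half] at this
  exact this ⟨h2, h1⟩

/-- A periodic solution with spectral parameter up to the upper edge that is orthogonal to the two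
lower edge functions is a multiple of the upper edge function. -/
theorem eq_of_orthogonal {lam : ℝ} (hlam : lam ≤ -(e₁ + e₂) + 2 * edgeRoot e₁ e₂) {f f' : ℝ → ℝ}
    (hf : IsPeriodicSolution L (profilePotential e₁ e₂ q) lam f f')
    (h0 : ∀ a, ∫ x in a..(a + L), f x * (q x ^ 2 - (e₁ + e₂ - edgeRoot e₁ e₂) / 3) = 0)
    (h1 : ∀ a, ∫ x in a..(a + L), f x * q' x = 0) :
    (∀ x, f x = 0) ∨ lam = -(e₁ + e₂) + 2 * edgeRoot e₁ e₂ ∧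
      ∃ c : ℝ, ∀ x, f x = c * (q x ^ 2 - (e₁ + e₂ + edgeRoot e₁ e₂) / 3) := by
  have hD := h.edgeRoot_pos
  have hl0 := h.lower_lt
  have hu2 := h.lt_upper
  have hu1 := h.upper_lt
  have hL := h.period_pos
  have hlow := h.isPeriodicSolution_lower
  have hder := h.isPeriodicSolution_deriv
  have hup := h.isPeriodicSolution_upper
  have hlt2 := h.lt_two_mul_edgeRoot
  have hsum : 0 < e₁ + e₂ := add_pos h.e₁_pos h.e₂_pos
  have hV := h.continuous_potential
  -- The zeros of the upper edge function in the period `[-z, -z + L)` are `-z` and `z`.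
  obtain ⟨z, hz, hqz⟩ := h.exists_sq_eq hu2 hu1
  set D := edgeRoot e₁ e₂ with hDdef
  set m₀ := (e₁ + e₂ - D) / 3 with hm₀
  set m₂ := (e₁ + e₂ + D) / 3 with hm₂
  set V := profilePotential e₁ e₂ q with hVdef
  have hq'z : q' z ≠ 0 := h.deriv_ne_zero (by rw [hqz]; exact hu2) (by rw [hqz]; exact hu1)
  have hqz0 := (h.pos z).ne'
  have hs : m₂ - m₀ ≠ 0 := by rw [hm₂, hm₀]; intro hc; linarith
  -- The coefficients make `g` vanish at `±z`: the even lower edge function cancels the even part of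
  -- `f` there, the odd `q'` cancels the odd part.
  let a : ℝ := -(f z + f (-z)) / (2 * (m₂ - m₀))
  let b : ℝ := -(f z - f (-z)) / (2 * q' z)
  let g : ℝ → ℝ := fun x => f x + (a * (q x ^ 2 - m₀) + b * q' x)
  let g' : ℝ → ℝ := fun x => f' x + (a * (2 * (q x * q' x)) + b * ((e₁ + e₂) * q x - 2 * q x ^ 3))
  let g'' : ℝ → ℝ := fun x => (V x - lam) * f x
    + (a * ((V x - (-(e₁ + e₂) - 2 * D)) * (q x ^ 2 - m₀)) + b * ((V x - 0) * q' x))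
  have hgz : g z = 0 := by
    simp only [g, a, b, hqz]
    field_simp
    ring
  have hgnz : g (-z) = 0 := by
    simp only [g, a, b, h.even, h.deriv_neg, hqz]
    field_simp
    ring
  have hgL : g (-z + L) = 0 := by
    rw [← hgnz]
    simp only [g, hf.periodic (-z), h.periodic (-z), h.periodic_deriv (-z)]
  have hgd : ∀ x, HasDerivAt g (g' x) x := fun x => (hf.hasDerivAt x).add
    (((hlow.hasDerivAt x).const_mul a).add ((hder.hasDerivAt x).const_mul b))
  have hgd' : ∀ x, HasDerivAt g' (g'' x) x := fun x => (hf.hasDerivAt_deriv x).add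
    (((hlow.hasDerivAt_deriv x).const_mul a).add ((hder.hasDerivAt_deriv x).const_mul b))
  have cf := hf.continuous
  have cq := h.continuous
  have cq' := h.continuous_deriv
  have cg'' : Continuous g'' := by fun_prop
  have cg : Continuous g := by fun_prop
  have hupz : q z ^ 2 - m₂ = 0 := by rw [hqz, sub_self]
  have hupnz : q (-z) ^ 2 - m₂ = 0 := by rw [h.even, hupz]
  have hupzL : q (-z + L) ^ 2 - m₂ = 0 := by rw [h.periodic, hupnz]
  have hupz' : 2 * (q z * q' z) ≠ 0 := by positivity
  have hupnz' : 2 * (q (-z) * q' (-z)) ≠ 0 := by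
    rw [h.even, h.deriv_neg]; intro hc; apply hupz'; linarith
  have hupzL' : 2 * (q (-z + L) * q' (-z + L)) ≠ 0 := by
    rw [h.periodic, h.periodic_deriv]; exact hupnz'
  have hI1 := integral_mul_nonneg_of_zeros (by linarith [hz.1] : -z < z) hup.hasDerivAt
    hup.hasDerivAt_deriv hgd hgd' cg'' hV hupnz hupz hupnz' hupz'
    (fun x hx hc => by
      have h3 := h.lt_of_abs_lt hz hx
      have h4 := h.pos z
      rw [← hqz] at hc
      nlinarith) hgnz hgz
  have hI2 := integral_mul_nonneg_of_zeros (by linarith [hz.2] : z < -z + L) hup.hasDerivAt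
    hup.hasDerivAt_deriv hgd hgd' cg'' hV hupz hupzL hupz' hupzL'
    (fun x hx hc => by
      have h3 := h.lt_of_mem_Ioo hz hx
      have h4 := h.pos x
      rw [← hqz] at hc
      nlinarith) hgz hgL
  have cI : Continuous fun x => (-g'' x + (V x - (-(e₁ + e₂) + 2 * D)) * g x) * g x := by fun_prop
  have hI := intervalIntegral.integral_add_adjacent_intervals
    (cI.intervalIntegrable (μ := volume) (-z) z) (cI.intervalIntegrable (μ := volume) z (-z + L))
  have h01 := hlow.integral_mul_eq_zero hder (by intro hc; linarith) (-z)
  -- Expansion of the form shifted by the upper edge. The cross terms integrate to zero by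
  -- orthogonality; the three squares carry the differences of `lam` and of the lower two
  -- eigenvalues with the upper edge, all nonpositive.
  have hexp : ∀ x, (-g'' x + (V x - (-(e₁ + e₂) + 2 * D)) * g x) * g x
      = (lam - (-(e₁ + e₂) + 2 * D)) * (f x * f x)
        + ((-4 * D) * a ^ 2 * ((q x ^ 2 - m₀) * (q x ^ 2 - m₀))
        + ((e₁ + e₂ - 2 * D) * b ^ 2 * (q' x * q' x)
        + (a * (lam - (-(e₁ + e₂) + 2 * D) - 4 * D) * (f x * (q x ^ 2 - m₀))
        + (b * (lam + 2 * (e₁ + e₂ - 2 * D)) * (f x * q' x)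
        + a * b * (e₁ + e₂ - 6 * D) * ((q x ^ 2 - m₀) * q' x))))) := by
    intro x
    simp only [g, g'']
    ring
  have hadd : ∀ u v : ℝ → ℝ, Continuous u → Continuous v → ∫ x in (-z)..(-z + L), (u x + v x) =
      (∫ x in (-z)..(-z + L), u x) + ∫ x in (-z)..(-z + L), v x := fun u v hu hv =>
    intervalIntegral.integral_add (hu.intervalIntegrable _ _) (hv.intervalIntegrable _ _)
  have htot : (lam - (-(e₁ + e₂) + 2 * D)) * (∫ x in (-z)..(-z + L), f x * f x)
        + ((-4 * D) * a ^ 2 * (∫ x in (-z)..(-z + L), (q x ^ 2 - m₀) * (q x ^ 2 - m₀))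
        + (e₁ + e₂ - 2 * D) * b ^ 2 * ∫ x in (-z)..(-z + L), q' x * q' x)
      = ∫ x in (-z)..(-z + L), (-g'' x + (V x - (-(e₁ + e₂) + 2 * D)) * g x) * g x := by
    simp only [hexp]
    rw [hadd _ _ (by fun_prop) (by fun_prop), hadd _ _ (by fun_prop) (by fun_prop),
      hadd _ _ (by fun_prop) (by fun_prop), hadd _ _ (by fun_prop) (by fun_prop),
      hadd _ _ (by fun_prop) (by fun_prop)]
    simp only [intervalIntegral.integral_const_mul, h0, h1, h01]
    ring
  have hzL : -z ≤ -z + L := by linarith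
  have hff : 0 ≤ ∫ x in (-z)..(-z + L), f x * f x :=
    intervalIntegral.integral_nonneg hzL fun x _ => mul_self_nonneg _
  have h00 : 0 < ∫ x in (-z)..(-z + L), (q x ^ 2 - m₀) * (q x ^ 2 - m₀) := by
    refine lt_of_not_ge fun hle => ?_
    have h3 := eq_zero_of_integral_sq_le_zero (by fun_prop) hlow.periodic hL hle z
    rw [hqz] at h3
    exact hs h3
  have h11 : 0 < ∫ x in (-z)..(-z + L), q' x * q' x := by
    refine lt_of_not_ge fun hle => hq'z ?_
    exact eq_zero_of_integral_sq_le_zero (by fun_prop) hder.periodic hL hle z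
  have t1 : 0 ≤ (-(e₁ + e₂) + 2 * D - lam) * ∫ x in (-z)..(-z + L), f x * f x :=
    mul_nonneg (by linarith) hff
  have t2 : 0 ≤ 4 * D * a ^ 2 * ∫ x in (-z)..(-z + L), (q x ^ 2 - m₀) * (q x ^ 2 - m₀) := by
    positivity
  have t3 : 0 ≤ (2 * D - (e₁ + e₂)) * b ^ 2 * ∫ x in (-z)..(-z + L), q' x * q' x :=
    mul_nonneg (mul_nonneg (by linarith) (sq_nonneg b)) h11.le
  -- The sum is nonnegative by the previous lemma and each term is nonpositive, so every term
  -- vanishes.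
  rcases hlam.lt_or_eq with hlt | heq
  · left
    refine eq_zero_of_integral_sq_le_zero cf hf.periodic hL (a := -z) ?_
    by_contra hc
    have := mul_pos (sub_pos.2 hlt) (not_le.1 hc)
    linarith
  · right
    -- Once `a = b = 0`, both functions vanish at `z`; the constant matches their derivatives there
    -- and uniqueness concludes.
    refine ⟨heq, f' z / (2 * (q z * q' z)), fun x => ?_⟩
    have ha : a = 0 := by
      by_contra ha
      have : 0 < 4 * D * a ^ 2 * ∫ x in (-z)..(-z + L), (q x ^ 2 - m₀) * (q x ^ 2 - m₀) := by
        positivity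
      linarith
    have hb : b = 0 := by
      by_contra hb
      have : 0 < (2 * D - (e₁ + e₂)) * b ^ 2 * ∫ x in (-z)..(-z + L), q' x * q' x :=
        mul_pos (mul_pos (by linarith) (by positivity)) h11
      linarith
    have hfz : f z = 0 := by simpa [g, ha, hb] using hgz
    rw [← heq] at hup
    have := (hf.add (hup.const_smul (-(f' z / (2 * (q z * q' z)))))).eq_zero h.abs_potential_le
      (x₀ := z) (by simp [hfz, hupz]) (by
        rw [smul_eq_mul, neg_mul, div_mul_cancel₀ _ hupz', add_neg_cancel]) x
    rw [smul_eq_mul] at this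
    linarith

/-- One Gram–Schmidt step. By periodicity the constant does not depend on where the period starts,
which allows later use of the period beginning at `-z`. -/
theorem projection_orthogonal {lam : ℝ} {V : ℝ → ℝ} {f f' y y' : ℝ → ℝ}
    (hf : IsPeriodicSolution L V lam f f') (hy : IsPeriodicSolution L V lam y y')
    {x₀ : ℝ} (hne : y x₀ ≠ 0) :
    ∃ c : ℝ, ∀ a, ∫ x in a..(a + L), (f x + (-c) • y x) * y x = 0 := by
  have cf := hf.continuous
  have cy := hy.continuous
  have hpos : ∫ x in (0 : ℝ)..(0 + L), y x * y x ≠ 0 := fun hle =>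
    hne (eq_zero_of_integral_sq_le_zero cy hy.periodic h.period_pos hle.le x₀)
  refine ⟨(∫ x in (0 : ℝ)..(0 + L), f x * y x) / ∫ x in (0 : ℝ)..(0 + L), y x * y x, fun a => ?_⟩
  set c := (∫ x in (0 : ℝ)..(0 + L), f x * y x) / ∫ x in (0 : ℝ)..(0 + L), y x * y x with hc
  have hp : Function.Periodic (fun x => (f x + (-c) • y x) * y x) L := fun x => by
    simp only [hf.periodic x, hy.periodic x]
  rw [hp.intervalIntegral_add_eq a 0]
  have : ∀ x, (f x + (-c) • y x) * y x = f x * y x + (-c) * (y x * y x) := fun x => by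
    rw [smul_eq_mul]; ring
  simp only [this]
  have ci : Continuous fun x => f x * y x := cf.mul cy
  have ci' : Continuous fun x => -c * (y x * y x) := by fun_prop
  rw [intervalIntegral.integral_add (ci.intervalIntegrable _ _) (ci'.intervalIntegrable _ _),
    intervalIntegral.integral_const_mul, hc, neg_mul, div_mul_cancel₀ _ hpos, add_neg_cancel]

/-- Real periodic solutions with spectral parameter up to the upper edge. -/
theorem eq_of_le {lam : ℝ} (hlam : lam ≤ -(e₁ + e₂) + 2 * edgeRoot e₁ e₂) {f f' : ℝ → ℝ}
    (hf : IsPeriodicSolution L (profilePotential e₁ e₂ q) lam f f') :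
    (∀ x, f x = 0) ∨
    (lam = -(e₁ + e₂) - 2 * edgeRoot e₁ e₂ ∧
      ∃ c : ℝ, ∀ x, f x = c * (q x ^ 2 - (e₁ + e₂ - edgeRoot e₁ e₂) / 3)) ∨
    (lam = 0 ∧ ∃ c : ℝ, ∀ x, f x = c * q' x) ∨
    (lam = -(e₁ + e₂) + 2 * edgeRoot e₁ e₂ ∧
      ∃ c : ℝ, ∀ x, f x = c * (q x ^ 2 - (e₁ + e₂ + edgeRoot e₁ e₂) / 3)) := by
  have hD := h.edgeRoot_pos
  have hlt2 := h.lt_two_mul_edgeRoot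
  have hsum : 0 < e₁ + e₂ := add_pos h.e₁_pos h.e₂_pos
  have hlow := h.isPeriodicSolution_lower
  have hder := h.isPeriodicSolution_deriv
  -- Orthogonality to an edge function is automatic unless `lam` is its eigenvalue; in that case the
  -- projection is subtracted first and the remainder must vanish.
  by_cases h0 : lam = -(e₁ + e₂) - 2 * edgeRoot e₁ e₂
  · right; left
    refine ⟨h0, ?_⟩
    subst h0
    obtain ⟨c, hc⟩ := h.projection_orthogonal hf hlow (x₀ := 0) (by
      rw [h.sq_zero]; have := h.lower_lt; have := h.lt; intro hc; linarith)
    have hg := hf.add (hlow.const_smul (-c))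
    refine ⟨c, fun x => ?_⟩
    rcases h.eq_of_orthogonal hlam hg hc
      (hg.integral_mul_eq_zero hder (by intro hc; linarith)) with hz | ⟨hz, -⟩
    · have := hz x
      rw [smul_eq_mul] at this
      linarith
    · linarith
  by_cases h1 : lam = 0
  · right; right; left
    refine ⟨h1, ?_⟩
    subst h1
    obtain ⟨z, -, hqz⟩ := h.exists_sq_eq h.lt_upper h.upper_lt
    obtain ⟨c, hc⟩ := h.projection_orthogonal hf hder (x₀ := z)
      (h.deriv_ne_zero (by rw [hqz]; exact h.lt_upper) (by rw [hqz]; exact h.upper_lt))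
    have hg := hf.add (hder.const_smul (-c))
    refine ⟨c, fun x => ?_⟩
    rcases h.eq_of_orthogonal hlam hg (hg.integral_mul_eq_zero hlow (by intro hc; linarith))
      hc with hz | ⟨hz, -⟩
    · have := hz x
      rw [smul_eq_mul] at this
      linarith
    · linarith
  rcases h.eq_of_orthogonal hlam hf (hf.integral_mul_eq_zero hlow h0)
    (hf.integral_mul_eq_zero hder h1) with hz | hz
  · exact Or.inl hz
  · exact Or.inr (Or.inr (Or.inr hz))

/-- Above the upper edge, a nonzero real periodic solution is accompanied by a second, linearly
independent one. -/
theorem exists_second_solution {lam : ℝ} (hlam : -(e₁ + e₂) + 2 * edgeRoot e₁ e₂ < lam)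
    {f f' : ℝ → ℝ} (hf : IsPeriodicSolution L (profilePotential e₁ e₂ q) lam f f') {x₀ : ℝ}
    (hne : f x₀ ≠ 0) :
    ∃ g g' : ℝ → ℝ, IsPeriodicSolution L (profilePotential e₁ e₂ q) lam g g' ∧
      f x₀ * g' x₀ - f' x₀ * g x₀ ≠ 0 := by
  -- `F` solves `F''' = 4(V - lam)F' + 2V'F`, the equation of products of two solutions; `G` and `H`
  -- are `F'` and `F''`.
  let F : ℝ → ℝ := fun x => q x ^ 4 - (e₁ + e₂ + lam / 3) * q x ^ 2
    + (e₁ * e₂ + lam * (e₁ + e₂) / 3 + lam ^ 2 / 9)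
  let G : ℝ → ℝ := fun x => (4 * q x ^ 3 - 2 * (e₁ + e₂ + lam / 3) * q x) * q' x
  let H : ℝ → ℝ := fun x => -20 * q x ^ 6 + (22 * (e₁ + e₂) + 2 * lam) * q x ^ 4
    - (12 * (e₁ * e₂) + 4 * (e₁ + e₂) * (e₁ + e₂ + lam / 3)) * q x ^ 2
    + 2 * (e₁ + e₂ + lam / 3) * (e₁ * e₂)
  let V := profilePotential e₁ e₂ q
  have hF : ∀ x, HasDerivAt F (G x) x := by
    intro x
    have := ((((h.hasDerivAt x).pow 4).sub (((h.hasDerivAt x).pow 2).const_mul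
      (e₁ + e₂ + lam / 3))).add_const (e₁ * e₂ + lam * (e₁ + e₂) / 3 + lam ^ 2 / 9))
    convert! this using 1
    simp only [G, Nat.cast_ofNat, Nat.add_one_sub_one, pow_one]
    ring
  have hG : ∀ x, HasDerivAt G (H x) x := by
    intro x
    have := ((((h.hasDerivAt x).pow 3).const_mul 4).sub ((h.hasDerivAt x).const_mul
      (2 * (e₁ + e₂ + lam / 3)))).mul (h.hasDerivAt_deriv x)
    convert! this using 1
    simp only [H, Nat.cast_ofNat, Nat.add_one_sub_one, Pi.sub_apply, Pi.pow_apply]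
    linear_combination (-12 * q x ^ 2 + 2 * (e₁ + e₂ + lam / 3)) * h.deriv_sq x
  have hH : ∀ x, HasDerivAt H (4 * (V x - lam) * G x - 24 * (q x * q' x) * F x) x := by
    intro x
    have := (((((h.hasDerivAt x).pow 6).const_mul (-20)).add (((h.hasDerivAt x).pow 4).const_mul
      (22 * (e₁ + e₂) + 2 * lam))).sub (((h.hasDerivAt x).pow 2).const_mul
      (12 * (e₁ * e₂) + 4 * (e₁ + e₂) * (e₁ + e₂ + lam / 3)))).add_const
      (2 * (e₁ + e₂ + lam / 3) * (e₁ * e₂))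
    convert! this using 1
    simp only [V, profilePotential, G, F, Nat.cast_ofNat, Nat.add_one_sub_one]
    ring
  refine ⟨fun x => F x * f' x - G x * f x / 2,
    fun x => G x * f' x / 2 + (F x * (V x - lam) - H x / 2) * f x, ⟨?_, ?_, ?_⟩, ?_⟩
  · intro x
    simp only [F, G, h.periodic x, h.periodic_deriv x, hf.periodic x, hf.periodic_deriv x]
  · intro x
    have := ((hF x).mul (hf.hasDerivAt_deriv x)).sub
      (((hG x).mul (hf.hasDerivAt x)).div_const 2)
    convert! this using 1
    simp only [V, smul_eq_mul]
    ring
  · intro x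
    have hVd : HasDerivAt (fun x => V x - lam) (-12 * (q x * q' x)) x := by
      have := ((((h.hasDerivAt x).pow 2).const_mul 6).const_sub (e₁ + e₂)).sub_const lam
      convert! this using 1
      simp only [Nat.cast_ofNat, Nat.add_one_sub_one, pow_one]
      ring
    have := (((hG x).mul (hf.hasDerivAt_deriv x)).div_const 2).add
      ((((hF x).mul hVd).sub ((hH x).div_const 2)).mul (hf.hasDerivAt x))
    convert! this using 1
    simp only [V, smul_eq_mul, Pi.mul_apply, Pi.sub_apply]
    ring
  · have hsq := edgeRoot_sq e₁ e₂
    have hD := h.edgeRoot_pos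
    have hlt2 := h.lt_two_mul_edgeRoot
    have he1 := h.e₁_pos
    have he2 := h.e₂_pos
    have hl0 : 0 < lam := by linarith
    -- The quadratic equals `(lam + e₁ + e₂)² - 4D²`, so its larger root is the upper edge.
    have hquad : 0 < lam ^ 2 + 2 * (e₁ + e₂) * lam + 12 * (e₁ * e₂) - 3 * (e₁ + e₂) ^ 2 := by
      nlinarith
    -- A quarter of the discriminant of the Wronskian form. It does not depend on the point: it is a
    -- quintic polynomial in `lam`, negative above the upper edge.
    have hdisc : G x₀ ^ 2 / 4 - F x₀ * H x₀ / 2 + (V x₀ - lam) * F x₀ ^ 2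
        = -(lam * (lam + 3 * e₁) * (lam + 3 * e₂)
          * (lam ^ 2 + 2 * (e₁ + e₂) * lam + 12 * (e₁ * e₂) - 3 * (e₁ + e₂) ^ 2)) / 81 := by
      simp only [G, F, H, V, profilePotential, mul_pow]
      rw [h.deriv_sq]
      ring
    have hneg : 0 < lam * (lam + 3 * e₁) * (lam + 3 * e₂)
          * (lam ^ 2 + 2 * (e₁ + e₂) * lam + 12 * (e₁ * e₂) - 3 * (e₁ + e₂) ^ 2) := by positivity
    intro hW
    have hform : F x₀ * f' x₀ ^ 2 - G x₀ * f x₀ * f' x₀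
        + (H x₀ / 2 - F x₀ * (V x₀ - lam)) * f x₀ ^ 2 = 0 := by
      linear_combination -hW
    -- Completing the square: a vanishing Wronskian would make this square equal to a negative
    -- multiple of `f x₀ ^ 2`.
    have hcomp : (F x₀ * f' x₀ - G x₀ * f x₀ / 2) ^ 2
        = (G x₀ ^ 2 / 4 - F x₀ * H x₀ / 2 + (V x₀ - lam) * F x₀ ^ 2) * f x₀ ^ 2 := by
      linear_combination F x₀ * hform
    have h3 := sq_nonneg (F x₀ * f' x₀ - G x₀ * f x₀ / 2)
    have h4 : 0 < f x₀ ^ 2 := by positivity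
    rw [hcomp, hdisc] at h3
    generalize lam * (lam + 3 * e₁) * (lam + 3 * e₂)
      * (lam ^ 2 + 2 * (e₁ + e₂) * lam + 12 * (e₁ * e₂) - 3 * (e₁ + e₂) ^ 2) = P at h3 hneg
    linarith [mul_pos hneg h4]

end IsDnoidalProfile

/-! ### Compact symmetric operators and operators with compact resolvent -/

section Abstract

open Module.End

variable {H : Type*} [NormedAddCommGroup H] [InnerProductSpace ℂ H]

/-- Otherwise there is an orthonormal sequence of eigenvectors whose images are pairwise at distance
at least `ε`, against compactness. -/
theorem finite_eigenvalues_of_le_norm {A : H →L[ℂ] H} (hA : IsCompactOperator A)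
    (hs : A.IsSymmetric) {ε : ℝ} (hε : 0 < ε) :
    {α : ℂ | HasEigenvalue (A : Module.End ℂ H) α ∧ ε ≤ ‖α‖}.Finite := by
  by_contra hinf
  have hinf : {α : ℂ | HasEigenvalue (A : Module.End ℂ H) α ∧ ε ≤ ‖α‖}.Infinite := hinf
  let α : ℕ → ℂ := fun n => hinf.natEmbedding _ n
  have hα : ∀ n, HasEigenvalue (A : Module.End ℂ H) (α n) ∧ ε ≤ ‖α n‖ := fun n =>
    (hinf.natEmbedding _ n).2
  have hinj : Function.Injective α :=
    Subtype.val_injective.comp (hinf.natEmbedding _).injective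
  have hex : ∀ n, ∃ e : H, ‖e‖ = 1 ∧ A e = α n • e := by
    intro n
    obtain ⟨v, hv⟩ := (hα n).1.exists_hasEigenvector
    refine ⟨((‖v‖ : ℂ)⁻¹) • v, ?_, ?_⟩
    · rw [norm_smul, norm_inv, Complex.norm_real, norm_norm,
        inv_mul_cancel₀ (norm_ne_zero_iff.2 hv.2)]
    · rw [map_smul, smul_comm]
      congr 1
      exact hv.apply_eq_smul
  choose e he1 heA using hex
  have horth : ∀ m n, m ≠ n → inner ℂ (e m) (e n) = 0 := by
    intro m n hmn
    have hne : α m ≠ α n := fun h => hmn (hinj h)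
    exact hs.orthogonalFamily_eigenspaces hne ⟨e m, mem_eigenspace_iff.2 (heA m)⟩
      ⟨e n, mem_eigenspace_iff.2 (heA n)⟩
  obtain ⟨K, hK, hK'⟩ := hA.image_closedBall_subset_compact 1
  obtain ⟨y, -, ψ, hψ, hψy⟩ := hK.tendsto_subseq
    (fun n => hK' ⟨e n, by simp [he1], rfl⟩ : ∀ n, A (e n) ∈ K)
  have hc := hψy.cauchySeq
  rw [Metric.cauchySeq_iff'] at hc
  obtain ⟨N, hN⟩ := hc ε hε
  have h1 := hN (N + 1) (Nat.le_succ N)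
  simp only [Function.comp_apply, dist_eq_norm] at h1
  have hne : ψ (N + 1) ≠ ψ N := fun h => by simpa using hψ.injective h
  have h2 : ‖A (e (ψ (N + 1))) - A (e (ψ N))‖ ^ 2
      = ‖A (e (ψ (N + 1)))‖ ^ 2 + ‖A (e (ψ N))‖ ^ 2 := by
    rw [@norm_sub_sq ℂ, heA, heA, inner_smul_left, inner_smul_right, horth _ _ hne]
    simp
  rw [heA (ψ (N + 1)), norm_smul, he1, mul_one] at h2
  have h3 := (hα (ψ (N + 1))).2
  have h4 := sq_nonneg ‖A (e (ψ N))‖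
  rw [heA (ψ (N + 1))] at h1
  nlinarith [norm_nonneg (α (ψ (N + 1)) • e (ψ (N + 1)) - A (e (ψ N)))]

/-- The eigenspaces span a dense subspace and, `0` being excluded, are finite-dimensional; finitely
many of them would make `H` finite-dimensional. -/
theorem infinite_eigenvalues [CompleteSpace H] {A : H →L[ℂ] H} (hA : IsCompactOperator A)
    (hs : A.IsSymmetric) (h0 : ¬ HasEigenvalue (A : Module.End ℂ H) 0)
    (hH : ¬ FiniteDimensional ℂ H) :
    {α : ℂ | HasEigenvalue (A : Module.End ℂ H) α}.Infinite := by
  intro hfin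
  have hbot := ContinuousLinearMap.orthogonalComplement_iSup_eigenspaces_eq_bot hA hs
  have hsup : (⨆ μ, Module.End.eigenspace (A : Module.End ℂ H) μ)
      = ⨆ μ ∈ {α : ℂ | HasEigenvalue (A : Module.End ℂ H) α},
          Module.End.eigenspace (A : Module.End ℂ H) μ := by
    refine le_antisymm (iSup_le fun μ => ?_) (iSup₂_le fun μ _ => le_iSup _ μ)
    by_cases hμ : HasEigenvalue (A : Module.End ℂ H) μ
    · exact le_iSup₂_of_le μ hμ le_rfl
    · rw [hasEigenvalue_iff, not_not] at hμ
      rw [hμ]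
      exact bot_le
  have hfd : FiniteDimensional ℂ ↥(⨆ μ, Module.End.eigenspace (A : Module.End ℂ H) μ) := by
    have := hfin.to_subtype
    have : ∀ μ : {α : ℂ | HasEigenvalue (A : Module.End ℂ H) α},
        FiniteDimensional ℂ (Module.End.eigenspace (A : Module.End ℂ H) (μ : ℂ)) := fun μ =>
      ContinuousLinearMap.finite_dimensional_eigenspace hA μ fun h => h0 (h ▸ μ.2)
    rw [hsup, iSup_subtype']
    exact Submodule.finiteDimensional_iSup _
  rw [Submodule.orthogonal_eq_bot_iff] at hbot
  rw [hbot] at hfd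
  exact hH ((Submodule.topEquiv (R := ℂ) (M := H)).finiteDimensional)

variable {T : H →ₗ.[ℂ] H}

theorem mem_eigenspace {z : ℂ} {x : T.domain} :
    x ∈ eigenspace T z ↔ T x = z • (x : H) := by
  unfold eigenspace
  rw [LinearMap.mem_ker, LinearMap.sub_apply, sub_eq_zero]
  rfl

/-- `A` is the bounded inverse of `T - z`. -/
structure IsResolvent (T : H →ₗ.[ℂ] H) (z : ℂ) (A : H →L[ℂ] H) : Prop where
  mem : ∀ y, A y ∈ T.domain
  right_inv : ∀ y, T ⟨A y, mem y⟩ - z • A y = y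
  left_inv : ∀ x : T.domain, A (T x - z • (x : H)) = x

theorem IsResolvent.mem_resolventSet {z : ℂ} {A : H →L[ℂ] H} (h : IsResolvent T z A) :
    z ∈ resolventSet T :=
  ⟨A, fun y => ⟨h.mem y, h.right_inv y⟩, h.left_inv⟩

theorem eigenspace_eq_bot_of_mem_resolventSet {z : ℂ} (h : z ∈ resolventSet T) :
    eigenspace T z = ⊥ := by
  obtain ⟨A, -, hA⟩ := h
  rw [Submodule.eq_bot_iff]
  intro x hx
  have := hA x
  rw [mem_eigenspace.1 hx, sub_self, map_zero] at this
  exact Subtype.ext this.symm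

theorem eigenvalue_im_eq_zero (hT : ∀ x y : T.domain, inner ℂ (T x) (y : H) = inner ℂ (x : H) (T y))
    {z : ℂ} (hz : eigenspace T z ≠ ⊥) : z.im = 0 := by
  obtain ⟨x, hx, hx0⟩ := Submodule.exists_mem_ne_zero_of_ne_bot hz
  have h := hT x x
  rw [mem_eigenspace.1 hx, inner_smul_left, inner_smul_right] at h
  have hne : inner ℂ (x : H) (x : H) ≠ 0 := by
    rw [inner_self_ne_zero]
    exact fun h => hx0 (Subtype.ext h)
  exact Complex.conj_eq_iff_im.1 (mul_right_cancel₀ hne h)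

theorem IsResolvent.isSymmetric {z : ℝ} {A : H →L[ℂ] H} (h : IsResolvent T (z : ℂ) A)
    (hT : ∀ x y : T.domain, inner ℂ (T x) (y : H) = inner ℂ (x : H) (T y)) : A.IsSymmetric := by
  intro x y
  change inner ℂ (A x) y = inner ℂ x (A y)
  have h1 := h.right_inv x
  have h2 := h.right_inv y
  have h3 := hT ⟨A x, h.mem x⟩ ⟨A y, h.mem y⟩
  nth_rewrite 1 [← h2]
  nth_rewrite 2 [← h1]
  rw [inner_sub_left, inner_sub_right, h3, inner_smul_left, inner_smul_right, Complex.conj_ofReal]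

theorem IsResolvent.not_hasEigenvalue_zero {z : ℂ} {A : H →L[ℂ] H} (h : IsResolvent T z A) :
    ¬ HasEigenvalue (A : Module.End ℂ H) 0 := by
  intro h0
  obtain ⟨v, hv⟩ := h0.exists_hasEigenvector
  have h1 : A v = 0 := by simpa using hv.apply_eq_smul
  have h2 := h.right_inv v
  have h3 : (⟨A v, h.mem v⟩ : T.domain) = 0 := Subtype.ext h1
  rw [h3, h1, smul_zero, sub_zero, LinearPMap.map_zero] at h2
  exact hv.2 h2.symm

theorem IsResolvent.eigenspace_ne_bot {z α : ℂ} {A : H →L[ℂ] H} (h : IsResolvent T z A)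
    (hα : HasEigenvalue (A : Module.End ℂ H) α) : eigenspace T (z + α⁻¹) ≠ ⊥ := by
  have hα0 : α ≠ 0 := fun h0 => h.not_hasEigenvalue_zero (h0 ▸ hα)
  obtain ⟨v, hv⟩ := hα.exists_hasEigenvector
  have h1 : A v = α • v := hv.apply_eq_smul
  have h2 := h.right_inv v
  rw [Submodule.ne_bot_iff]
  -- The witness is `A v`, a nonzero multiple of `v`, because it lies in the domain by construction.
  refine ⟨⟨A v, h.mem v⟩, ?_, ?_⟩
  · rw [mem_eigenspace, add_smul]
    change _ = z • A v + α⁻¹ • A v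
    rw [show α⁻¹ • A v = v by rw [h1, inv_smul_smul₀ hα0], add_comm]
    exact sub_eq_iff_eq_add.1 h2
  · intro h0
    have h3 : A v = 0 := congrArg Subtype.val h0
    rw [h1] at h3
    exact (smul_ne_zero hα0 hv.2) h3

theorem IsResolvent.hasEigenvalue {z w : ℂ} {A : H →L[ℂ] H} (h : IsResolvent T z A)
    (hw : eigenspace T w ≠ ⊥) : HasEigenvalue (A : Module.End ℂ H) (w - z)⁻¹ := by
  have hwz : w - z ≠ 0 := by
    rw [sub_ne_zero]
    rintro rfl
    exact hw (eigenspace_eq_bot_of_mem_resolventSet h.mem_resolventSet)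
  obtain ⟨x, hx, hx0⟩ := Submodule.exists_mem_ne_zero_of_ne_bot hw
  refine hasEigenvalue_of_hasEigenvector (x := (x : H)) ⟨mem_eigenspace_iff.2 ?_, ?_⟩
  · have h1 := h.left_inv x
    rw [PeriodicHill.mem_eigenspace.1 hx, ← sub_smul, map_smul] at h1
    rw [eq_inv_smul_iff₀ hwz]
    exact h1
  · exact fun h => hx0 (Subtype.ext h)

/-- The eigenvalues of a symmetric operator with compact resolvent, bounded below by a point of
the resolvent set, form an infinite set without finite accumulation points. -/
theorem infinite_and_finite_eigenvalues [CompleteSpace H] (hH : ¬ FiniteDimensional ℂ H)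
    (hT : ∀ x y : T.domain, inner ℂ (T x) (y : H) = inner ℂ (x : H) (T y)) {z : ℝ}
    {A : H →L[ℂ] H} (h : IsResolvent T (z : ℂ) A) (hA : IsCompactOperator A)
    (hz : ∀ t : ℝ, eigenspace T (t : ℂ) ≠ ⊥ → z < t) :
    {t : ℝ | eigenspace T (t : ℂ) ≠ ⊥}.Infinite ∧
      ∀ M : ℝ, ({t : ℝ | eigenspace T (t : ℂ) ≠ ⊥} ∩ Set.Iic M).Finite := by
  have hs := h.isSymmetric hT
  constructor
  · intro hfin
    refine infinite_eigenvalues hA hs h.not_hasEigenvalue_zero hH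
      ((hfin.image fun t : ℝ => ((t : ℂ) - z)⁻¹).subset ?_)
    intro α hα
    have h1 := h.eigenspace_ne_bot hα
    have h2 := eigenvalue_im_eq_zero hT h1
    have h3 : (((z : ℂ) + α⁻¹).re : ℂ) = z + α⁻¹ := Complex.ext rfl (by rw [h2]; rfl)
    refine ⟨((z : ℂ) + α⁻¹).re, ?_, ?_⟩
    · rw [← h3] at h1
      exact h1
    · simp only [h3]
      rw [add_sub_cancel_left, inv_inv]
  · intro M
    rcases le_or_gt M z with hMz | hMz
    · convert! Set.finite_empty
      rw [Set.eq_empty_iff_forall_notMem]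
      rintro t ⟨h1, h2⟩
      exact absurd (hz t h1) (not_lt.2 (le_trans h2 hMz))
    -- Eigenvalues in `(z, M]` go injectively to eigenvalues `1 / (t - z) ≥ 1 / (M - z)` of the
    -- compact operator.
    have hε : 0 < (M - z)⁻¹ := inv_pos.2 (sub_pos.2 hMz)
    refine Set.Finite.of_finite_image (f := fun t : ℝ => ((t : ℂ) - z)⁻¹)
      ((finite_eigenvalues_of_le_norm hA hs hε).subset ?_) ?_
    · rintro _ ⟨t, ⟨h1, h2⟩, rfl⟩
      refine ⟨h.hasEigenvalue h1, ?_⟩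
      have h3 := hz t h1
      rw [norm_inv, ← Complex.ofReal_sub, Complex.norm_real, Real.norm_of_nonneg (by linarith)]
      have h4 : t ≤ M := h2
      gcongr
    · intro s _ t _ hst
      simpa using hst

end Abstract

/-! ### The Hill operator has compact resolvent -/

section HillResolvent

/-- The symbol `1 / ((2πn/L)² + 1)` of `(1 - d²/dx²)⁻¹`. -/
noncomputable def invSymbol (L : ℝ) (n : ℤ) : ℝ := 1 / ((2 * Real.pi * n / L) ^ 2 + 1)

theorem invSymbol_pos (L : ℝ) (n : ℤ) : 0 < invSymbol L n := by
  unfold invSymbol; positivity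

theorem summable_inv_one_add_sq : Summable fun n : ℤ => 1 / (1 + (n : ℝ) ^ 2) := by
  -- The comparison holds only for `n ≠ 0`, since `1 / 0 = 0`.
  refine Summable.of_norm_bounded_eventually
    (g := fun n : ℤ => 1 / (n : ℝ) ^ 2) (Real.summable_one_div_int_pow.2 one_lt_two) ?_
  filter_upwards [(Set.finite_singleton (0 : ℤ)).compl_mem_cofinite] with n hn
  have : (n : ℝ) ≠ 0 := by exact_mod_cast hn
  rw [Real.norm_of_nonneg (by positivity)]
  gcongr
  linarith

variable {L : ℝ} [hL : Fact (0 < L)]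

theorem L2per_ext {f g : L2per L} (h : ∀ n : ℤ, fourierCoeff f n = fourierCoeff g n) : f = g := by
  apply fourierBasis.repr.injective
  ext n
  rw [fourierBasis_repr, fourierBasis_repr, h]

theorem fourierCoeff_add_L2per (f g : L2per L) (n : ℤ) :
    fourierCoeff ((f + g : L2per L) : AddCircle L → ℂ) n = fourierCoeff f n + fourierCoeff g n := by
  simp only [← fourierBasis_repr, map_add]; rfl

theorem fourierCoeff_negSecondDeriv (f : H2per L) (n : ℤ) :
    fourierCoeff (negSecondDeriv L f) n
      = (((2 * Real.pi * n / L) ^ 2 : ℝ) : ℂ) * fourierCoeff (f : L2per L) n := by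
  rw [← fourierBasis_repr]
  change (fourierBasis.repr (fourierBasis.repr.symm _)) n = _
  rw [LinearIsometryEquiv.apply_symm_apply]

theorem not_finiteDimensional_L2per : ¬ FiniteDimensional ℂ (L2per L) := by
  intro h
  have h1 := (orthonormal_fourier (T := L)).linearIndependent
  have := h1.finite
  exact not_finite ℤ

theorem one_add_sq_mul_invSymbol_le (n : ℤ) :
    (1 + (n : ℝ) ^ 2) * invSymbol L n ≤ 1 + (L / (2 * Real.pi)) ^ 2 := by
  have hL0 := hL.out
  have hpi := Real.pi_pos
  rw [invSymbol, mul_one_div, div_le_iff₀ (by positivity)]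
  have h : (2 * Real.pi * n / L) ^ 2 * (L / (2 * Real.pi)) ^ 2 = (n : ℝ) ^ 2 := by
    field_simp
  have h1 : 0 ≤ (2 * Real.pi * n / L) ^ 2 := sq_nonneg _
  have h2 : 0 ≤ (L / (2 * Real.pi)) ^ 2 := sq_nonneg _
  nlinarith

theorem summable_invSymbol : Summable (invSymbol L) := by
  refine Summable.of_nonneg_of_le (fun n => (invSymbol_pos L n).le) (fun n => ?_)
    (summable_inv_one_add_sq.mul_left (1 + (L / (2 * Real.pi)) ^ 2))
  rw [mul_one_div, le_div_iff₀ (by positivity), mul_comm]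
  exact one_add_sq_mul_invSymbol_le n

/-- The operator `(1 - d²/dx²)⁻¹` on `L²_per([0,L])`. -/
noncomputable def freeResolvent (L : ℝ) [Fact (0 < L)] : L2per L →L[ℂ] L2per L :=
  ∑' n : ℤ, (invSymbol L n : ℂ) •
    InnerProductSpace.rankOne ℂ (fourierLp (T := L) 2 n) (fourierLp (T := L) 2 n)

theorem summable_freeResolvent : Summable fun n : ℤ => (invSymbol L n : ℂ) •
    InnerProductSpace.rankOne ℂ (fourierLp (T := L) 2 n) (fourierLp (T := L) 2 n) := by
  refine Summable.of_norm ?_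
  refine (summable_invSymbol (L := L)).congr fun n => ?_
  rw [norm_smul, InnerProductSpace.norm_rankOne, (orthonormal_fourier (T := L)).1 n,
    Complex.norm_real, Real.norm_of_nonneg (invSymbol_pos L n).le, mul_one, mul_one]

/-- The symbol is summable, so the operator is a norm limit of finite-rank partial sums. -/
theorem isCompactOperator_freeResolvent : IsCompactOperator (freeResolvent L) := by
  refine isCompactOperator_of_tendsto summable_freeResolvent.hasSum
    (Eventually.of_forall fun s => ?_)
  have : ∀ n : ℤ, (invSymbol L n : ℂ) •
      InnerProductSpace.rankOne ℂ (fourierLp (T := L) 2 n) (fourierLp (T := L) 2 n)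
        ∈ compactOperator (RingHom.id ℂ) (L2per L) (L2per L) := by
    intro n
    refine Submodule.smul_mem _ _ ?_
    change IsCompactOperator _
    rw [InnerProductSpace.rankOne_def']
    have h : IsCompactOperator (innerSL ℂ (fourierLp (T := L) 2 n)) :=
      isCompactOperator_of_locallyCompactSpace_dom (innerSL ℂ (fourierLp (T := L) 2 n))
    exact h.clm_comp (ContinuousLinearMap.toSpanSingleton ℂ (fourierLp (T := L) 2 n))
  exact Submodule.sum_mem _ fun n _ => this n

theorem fourierCoeff_freeResolvent (f : L2per L) (n : ℤ) :
    fourierCoeff (freeResolvent L f) n = invSymbol L n * fourierCoeff f n := by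
  have h1 := ((summable_freeResolvent (L := L)).hasSum.mapL
    (ContinuousLinearMap.apply ℂ (L2per L) f)).mapL (innerSL ℂ (fourierLp (T := L) 2 n))
  have hcoef : ∀ g : L2per L, fourierCoeff g n = inner ℂ (fourierLp (T := L) 2 n) g := by
    intro g
    rw [← fourierBasis_repr, HilbertBasis.repr_apply_apply, coe_fourierBasis]
  have h2 := h1.unique (hasSum_single n fun m hm => ?_)
  · rw [hcoef, hcoef]
    refine h2.trans ?_
    simp only [ContinuousLinearMap.apply_apply, smul_apply,
      InnerProductSpace.rankOne_apply, innerSL_apply_apply, inner_smul_right]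
    rw [inner_self_eq_norm_sq_to_K, (orthonormal_fourier (T := L)).1 n]
    simp
  · simp only [ContinuousLinearMap.apply_apply, smul_apply,
      InnerProductSpace.rankOne_apply, innerSL_apply_apply, inner_smul_right]
    rw [(orthonormal_fourier (T := L)).2 hm.symm, mul_zero, mul_zero]

theorem summable_sq_fourierCoeff (f : L2per L) : Summable fun n : ℤ => ‖fourierCoeff f n‖ ^ 2 :=
  (hasSum_sq_fourierCoeff f).summable

theorem freeResolvent_mem (f : L2per L) : freeResolvent L f ∈ H2per L := by
  change Summable fun n : ℤ => (1 + (n : ℝ) ^ 2) ^ 2 * ‖fourierCoeff (freeResolvent L f) n‖ ^ 2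
  refine Summable.of_nonneg_of_le (fun n => by positivity) (fun n => ?_)
    ((summable_sq_fourierCoeff f).mul_left ((1 + (L / (2 * Real.pi)) ^ 2) ^ 2))
  rw [fourierCoeff_freeResolvent, norm_mul, Complex.norm_real,
    Real.norm_of_nonneg (invSymbol_pos L n).le, mul_pow, ← mul_assoc, ← mul_pow]
  have h := one_add_sq_mul_invSymbol_le (L := L) n
  have h0 : 0 ≤ (1 + (n : ℝ) ^ 2) * invSymbol L n :=
    mul_nonneg (by positivity) (invSymbol_pos L n).le
  gcongr

theorem negSecondDeriv_freeResolvent (f : L2per L) :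
    negSecondDeriv L ⟨freeResolvent L f, freeResolvent_mem f⟩ + freeResolvent L f = f := by
  refine L2per_ext fun n => ?_
  rw [fourierCoeff_add_L2per, fourierCoeff_negSecondDeriv, fourierCoeff_freeResolvent, invSymbol]
  have h : 0 ≤ (2 * Real.pi * n / L) ^ 2 := sq_nonneg _
  generalize (2 * Real.pi * n / L) ^ 2 = d at h ⊢
  have h1 : (d : ℂ) + 1 ≠ 0 := by exact_mod_cast (by positivity : d + 1 ≠ 0)
  push_cast
  field_simp

theorem freeResolvent_negSecondDeriv (f : H2per L) :
    freeResolvent L (negSecondDeriv L f + f) = f := by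
  refine L2per_ext fun n => ?_
  rw [fourierCoeff_freeResolvent, fourierCoeff_add_L2per, fourierCoeff_negSecondDeriv, invSymbol]
  have h : 0 ≤ (2 * Real.pi * n / L) ^ 2 := sq_nonneg _
  generalize (2 * Real.pi * n / L) ^ 2 = d at h ⊢
  have h1 : (d : ℂ) + 1 ≠ 0 := by exact_mod_cast (by positivity : d + 1 ≠ 0)
  push_cast
  field_simp

theorem coeFn_mulPotential (V : C(AddCircle L, ℝ)) (f : L2per L) :
    mulPotential V f =ᵐ[AddCircle.haarAddCircle] fun x => (V x : ℂ) * f x :=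
  MemLp.coeFn_toLp (memLp_potential V f)

/-- Multiplication by `V` as a bounded operator. -/
noncomputable def mulPotentialCLM (V : C(AddCircle L, ℝ)) : L2per L →L[ℂ] L2per L :=
  (mulPotential V).mkContinuous ‖V‖ fun f => by
    refine Lp.norm_le_mul_norm_of_ae_le_mul ?_
    filter_upwards [coeFn_mulPotential V f] with x hx
    rw [hx, norm_mul, Complex.norm_real]
    exact mul_le_mul_of_nonneg_right (V.norm_coe_le_norm x) (norm_nonneg _)

theorem inner_mulPotential (V : C(AddCircle L, ℝ)) (f g : L2per L) :
    inner ℂ (mulPotential V f) g = inner ℂ f (mulPotential V g) := by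
  rw [L2.inner_def, L2.inner_def]
  refine integral_congr_ae ?_
  filter_upwards [coeFn_mulPotential V f, coeFn_mulPotential V g] with x hf hg
  rw [hf, hg]
  simp only [RCLike.inner_apply, map_mul, Complex.conj_ofReal]
  ring

theorem inner_negSecondDeriv (f g : H2per L) :
    inner ℂ (negSecondDeriv L f) (g : L2per L) = inner ℂ (f : L2per L) (negSecondDeriv L g) := by
  rw [← fourierBasis.repr.inner_map_map, ← fourierBasis.repr.inner_map_map (f : L2per L),
    lp.inner_eq_tsum, lp.inner_eq_tsum]
  refine tsum_congr fun n => ?_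
  simp only [fourierBasis_repr, fourierCoeff_negSecondDeriv, RCLike.inner_apply, map_mul,
    Complex.conj_ofReal]
  ring

theorem hillOperator_apply (V : C(AddCircle L, ℝ)) (f : (hillOperator V).domain) :
    hillOperator V f = negSecondDeriv L f + mulPotential V (f : L2per L) := rfl

theorem hillOperator_symmetric (V : C(AddCircle L, ℝ)) (f g : (hillOperator V).domain) :
    inner ℂ (hillOperator V f) (g : L2per L) = inner ℂ (f : L2per L) (hillOperator V g) := by
  rw [hillOperator_apply, hillOperator_apply, inner_add_left, inner_add_right,
    inner_mulPotential]
  congr 1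
  exact inner_negSecondDeriv f g

/-- Outside of its eigenvalues, the Hill operator has a compact resolvent. -/
theorem exists_isResolvent (V : C(AddCircle L, ℝ)) {z : ℂ}
    (hz : eigenspace (hillOperator V) z = ⊥) :
    ∃ A : L2per L →L[ℂ] L2per L, IsCompactOperator A ∧ IsResolvent (hillOperator V) z A := by
  -- On the domain `T - z = (1 - d²/dx²) + M`, which `freeResolvent` turns into `1 + C` with `C`
  -- compact. The Fredholm alternative inverts `1 + C` once `-1` is not an eigenvalue of `C`.
  let M : L2per L →L[ℂ] L2per L := mulPotentialCLM V - (1 + z) • ContinuousLinearMap.id ℂ _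
  let C : L2per L →L[ℂ] L2per L := (freeResolvent L).comp M
  have hM : ∀ f, M f = mulPotential V f - (1 + z) • f := fun f => rfl
  have hC : IsCompactOperator C := isCompactOperator_freeResolvent.comp_clm M
  have key : ∀ (f : L2per L) (y : L2per L), f + C f = freeResolvent L y →
      ∃ h : f ∈ (hillOperator V).domain, hillOperator V ⟨f, h⟩ - z • f = y := by
    intro f y hf
    -- Regularity gain: the equation exhibits `f` in the range of `freeResolvent`, hence in `H2per
    -- L`.
    have h1 : f = freeResolvent L (y - M f) := by
      rw [map_sub, ← hf]
      exact (add_sub_cancel_right _ _).symm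
    have hmem : f ∈ H2per L := by rw [h1]; exact freeResolvent_mem _
    refine ⟨hmem, ?_⟩
    have h2 : negSecondDeriv L ⟨f, hmem⟩ + f = y - M f := by
      have := negSecondDeriv_freeResolvent (y - M f)
      convert! this using 2
      congr 1
      exact Subtype.ext h1
    rw [hillOperator_apply]
    have h3 := eq_sub_of_add_eq h2
    change negSecondDeriv L ⟨f, hmem⟩ + mulPotential V f - z • f = y
    rw [h3, hM]
    module
  have hneg : ¬ Module.End.HasEigenvalue (C : Module.End ℂ (L2per L)) (-1) := by
    intro hev
    obtain ⟨v, hv⟩ := hev.exists_hasEigenvector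
    have h1 : C v = (-1 : ℂ) • v := hv.apply_eq_smul
    obtain ⟨hmem, h2⟩ := key v 0 (by rw [h1, map_zero, neg_one_smul, add_neg_cancel])
    have h3 : (⟨v, hmem⟩ : (hillOperator V).domain) ∈ eigenspace (hillOperator V) z :=
      mem_eigenspace.2 (sub_eq_zero.1 h2)
    rw [hz, Submodule.mem_bot] at h3
    exact hv.2 (congrArg Subtype.val h3)
  have hres := (hC.hasEigenvalue_or_mem_resolventSet (neg_ne_zero.2 one_ne_zero)).resolve_left hneg
  obtain ⟨u, hu⟩ : IsUnit (algebraMap ℂ (L2per L →L[ℂ] L2per L) (-1) - C) := hres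
  have hu' : ∀ f, (u : L2per L →L[ℂ] L2per L) f = -(f + C f) := by
    intro f
    rw [hu, sub_apply, Algebra.algebraMap_eq_smul_one,
      smul_apply, one_apply_eq_self]
    module
  let G : L2per L →L[ℂ] L2per L := -(↑u⁻¹ : L2per L →L[ℂ] L2per L)
  have hG1 : ∀ f, G f + C (G f) = f := by
    intro f
    have : (u : L2per L →L[ℂ] L2per L) ((↑u⁻¹ : L2per L →L[ℂ] L2per L) f) = f := by
      rw [← mul_apply_eq_comp, u.mul_inv, one_apply_eq_self]
    rw [hu'] at this
    change -(↑u⁻¹ : L2per L →L[ℂ] L2per L) f + C (-(↑u⁻¹ : L2per L →L[ℂ] L2per L) f) = f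
    rw [map_neg, ← neg_add]
    exact this
  have hG2 : ∀ f, G (f + C f) = f := by
    intro f
    have : (↑u⁻¹ : L2per L →L[ℂ] L2per L) ((u : L2per L →L[ℂ] L2per L) f) = f := by
      rw [← mul_apply_eq_comp, u.inv_mul, one_apply_eq_self]
    rw [hu', map_neg] at this
    exact this
  refine ⟨G.comp (freeResolvent L), isCompactOperator_freeResolvent.clm_comp G,
    fun y => (key _ y (hG1 _)).1, fun y => (key _ y (hG1 _)).2, fun x => ?_⟩
  have h1 : freeResolvent L (hillOperator V x - z • (x : L2per L)) = x + C x := by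
    have : hillOperator V x - z • (x : L2per L) = (negSecondDeriv L x + x) + M x := by
      rw [hillOperator_apply, hM]
      module
    rw [this]
    exact (map_add (freeResolvent L) _ _).trans
      (congrArg (· + C (x : L2per L)) (freeResolvent_negSecondDeriv x))
  rw [ContinuousLinearMap.comp_apply, h1, hG2]

theorem mem_spectrum_hillOperator (V : C(AddCircle L, ℝ)) {z : ℂ} :
    z ∈ PeriodicHill.spectrum (hillOperator V) ↔ eigenspace (hillOperator V) z ≠ ⊥ := by
  refine ⟨fun h hz => h ?_, fun h hz => h (eigenspace_eq_bot_of_mem_resolventSet hz)⟩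
  obtain ⟨A, -, hA⟩ := exists_isResolvent V hz
  exact hA.mem_resolventSet

end HillResolvent

/-! ### Eigenvectors of the Hill operator are classical periodic solutions -/

section Regularity

variable {L : ℝ}

/-- A continuous periodic function as a continuous function on the circle. -/
def circleLift {E : Type*} [TopologicalSpace E] (y : ℝ → E) (hc : Continuous y)
    (hp : Function.Periodic y L) : C(AddCircle L, E) :=
  ⟨hp.lift, continuous_coinduced_dom.2 hc⟩

@[simp] theorem circleLift_coe {E : Type*} [TopologicalSpace E] (y : ℝ → E) (hc : Continuous y)
    (hp : Function.Periodic y L) (x : ℝ) : circleLift y hc hp (x : AddCircle L) = y x :=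
  hp.lift_coe x

theorem circle_ext {E : Type*} [TopologicalSpace E] {F G : C(AddCircle L, E)}
    (h : ∀ x : ℝ, F (x : AddCircle L) = G (x : AddCircle L)) : F = G := by
  ext x
  induction x using QuotientAddGroup.induction_on with
  | H x => exact h x

theorem periodic_coe_circle {E : Type*} (F : AddCircle L → E) :
    Function.Periodic (fun x : ℝ => F (x : AddCircle L)) L := fun x => by
  simp only [AddCircle.coe_add_period]

theorem continuous_coe_circle {E : Type*} [TopologicalSpace E] (F : C(AddCircle L, E)) :
    Continuous fun x : ℝ => F (x : AddCircle L) :=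
  F.continuous.comp (AddCircle.continuous_mk' L)

variable [hL : Fact (0 < L)]

theorem fourierCoeff_of_hasDerivAt {F G : C(AddCircle L, ℂ)}
    (h : ∀ x : ℝ, HasDerivAt (fun x : ℝ => F x) (G x) x) (n : ℤ) :
    fourierCoeff G n = 2 * Real.pi * Complex.I * n / L * fourierCoeff F n := by
  have cF := continuous_coe_circle F
  have cG := continuous_coe_circle G
  have ce := continuous_coe_circle (fourier (T := L) (-n))
  have hd : ∀ x : ℝ, HasDerivAt (fun x : ℝ => fourier (-n) (x : AddCircle L) * F x)
      ((-(2 * Real.pi * Complex.I * n / L)) * (fourier (-n) (x : AddCircle L) * F x)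
        + fourier (-n) (x : AddCircle L) * G x) x := by
    intro x
    have := (hasDerivAt_fourier_neg L n x).mul (h x)
    convert! this using 1
    ring
  have ci : Continuous fun x : ℝ =>
      (-(2 * Real.pi * Complex.I * n / L)) * (fourier (-n) (x : AddCircle L) * F x) := by fun_prop
  have ci' : Continuous fun x : ℝ => fourier (-n) (x : AddCircle L) * G x := by fun_prop
  have hint := intervalIntegral.integral_eq_sub_of_hasDerivAt (a := 0) (b := 0 + L)
    (fun x _ => hd x) ((ci.add ci').intervalIntegrable _ _)
  rw [AddCircle.coe_add_period, sub_self, intervalIntegral.integral_add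
    (ci.intervalIntegrable _ _) (ci'.intervalIntegrable _ _),
    intervalIntegral.integral_const_mul] at hint
  rw [fourierCoeff_eq_intervalIntegral _ n 0, fourierCoeff_eq_intervalIntegral _ n 0]
  simp only [smul_eq_mul, Complex.real_smul]
  linear_combination (((1 / L : ℝ) : ℂ)) * hint

/-- Zero mean is what makes the primitive periodic; subtracting the mean of the primitive lets the
construction be repeated. -/
theorem exists_antiderivative {h : C(AddCircle L, ℂ)} (h0 : fourierCoeff h 0 = 0) :
    ∃ P : C(AddCircle L, ℂ), (∀ x : ℝ, HasDerivAt (fun x : ℝ => P x) (h x) x) ∧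
      fourierCoeff P 0 = 0 := by
  have hL0 := hL.out
  have ch := continuous_coe_circle h
  have hz : ∀ F : AddCircle L → ℂ, fourierCoeff F 0
      = ((1 / L : ℝ) : ℂ) * ∫ x in (0 : ℝ)..(0 + L), F x := fun F => by
    rw [fourierCoeff_eq_intervalIntegral _ 0 0]
    simp
  have hLc : ((1 / L : ℝ) : ℂ) ≠ 0 := by exact_mod_cast (one_div_pos.2 hL0).ne'
  have hint : ∫ x in (0 : ℝ)..(0 + L), h x = 0 := by
    rw [hz] at h0
    exact (mul_eq_zero.1 h0).resolve_left hLc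
  let p : ℝ → ℂ := fun x => ∫ t in (0 : ℝ)..x, h t
  have hpd : ∀ x : ℝ, HasDerivAt p (h x) x := fun x =>
    (ch.integral_hasStrictDerivAt 0 x).hasDerivAt
  have cp : Continuous p := continuous_iff_continuousAt.2 fun x => (hpd x).continuousAt
  have hpp : Function.Periodic p L := fun x => by
    have h1 := (periodic_coe_circle (L := L) h).intervalIntegral_add_eq x 0
    rw [hint] at h1
    have h2 := intervalIntegral.integral_add_adjacent_intervals
      (ch.intervalIntegrable (μ := volume) 0 x) (ch.intervalIntegrable (μ := volume) x (x + L))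
    rw [h1, add_zero] at h2
    exact h2.symm
  let m : ℂ := ((1 / L : ℝ) : ℂ) * ∫ x in (0 : ℝ)..(0 + L), p x
  have hpm : Function.Periodic (fun x => p x - m) L := fun x => by simp only [hpp x]
  refine ⟨circleLift (fun x => p x - m) (cp.sub continuous_const) hpm, fun x => ?_, ?_⟩
  · simp only [circleLift_coe]
    exact (hpd x).sub_const m
  · rw [hz]
    simp only [circleLift_coe]
    rw [intervalIntegral.integral_sub (cp.intervalIntegrable _ _)
      (continuous_const.intervalIntegrable _ _), intervalIntegral.integral_const]
    simp only [zero_add, sub_zero, m, Complex.real_smul]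
    push_cast
    have : (L : ℂ) ≠ 0 := by exact_mod_cast hL0.ne'
    field_simp
    simp

/-- The class in `L²_per` of a continuous function. -/
noncomputable abbrev toL2per (Y : C(AddCircle L, ℂ)) : L2per L :=
  ContinuousMap.toLp 2 AddCircle.haarAddCircle ℂ Y

theorem toL2per_injective : Function.Injective (toL2per (L := L)) :=
  ContinuousMap.toLp_injective _

theorem negSecondDeriv_of_hasDerivAt {Y Y' Y'' : C(AddCircle L, ℂ)}
    (h : ∀ x : ℝ, HasDerivAt (fun x : ℝ => Y x) (Y' x) x)
    (h' : ∀ x : ℝ, HasDerivAt (fun x : ℝ => Y' x) (Y'' x) x) :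
    ∃ hmem : toL2per Y ∈ H2per L, negSecondDeriv L ⟨toL2per Y, hmem⟩ = -toL2per Y'' := by
  have hc : ∀ n : ℤ, fourierCoeff Y'' n
      = -(((2 * Real.pi * n / L) ^ 2 : ℝ) : ℂ) * fourierCoeff Y n := by
    intro n
    rw [fourierCoeff_of_hasDerivAt h', fourierCoeff_of_hasDerivAt h]
    push_cast
    linear_combination (4 * Real.pi ^ 2 * n ^ 2 / L ^ 2 : ℂ) * fourierCoeff Y n * Complex.I_sq
  -- Membership in `H2per L` comes from the range of `freeResolvent`.
  have hR : toL2per Y = freeResolvent L (toL2per (Y - Y'')) := by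
    refine L2per_ext fun n => ?_
    have : toL2per (Y - Y'') = toL2per Y + (-1 : ℂ) • toL2per Y'' := by
      rw [toL2per, map_sub, neg_one_smul, sub_eq_add_neg]
    have h2 : fourierCoeff ((-1 : ℂ) • toL2per Y'' : L2per L) n = -fourierCoeff Y'' n := by
      rw [← fourierCoeff_toLp]
      simp only [← fourierBasis_repr, map_smul]
      exact neg_one_mul _
    rw [fourierCoeff_freeResolvent, this, fourierCoeff_add_L2per, h2, fourierCoeff_toLp, hc,
      invSymbol]
    have h : 0 ≤ (2 * Real.pi * n / L) ^ 2 := sq_nonneg _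
    generalize (2 * Real.pi * n / L) ^ 2 = d at h ⊢
    have h1 : (d : ℂ) + 1 ≠ 0 := by exact_mod_cast (by positivity : d + 1 ≠ 0)
    push_cast
    field_simp
    ring
  have hmem : toL2per Y ∈ H2per L := by rw [hR]; exact freeResolvent_mem _
  refine ⟨hmem, L2per_ext fun n => ?_⟩
  have h2 : fourierCoeff ((-toL2per Y'' : L2per L) : AddCircle L → ℂ) n = -fourierCoeff Y'' n := by
    rw [← fourierCoeff_toLp]
    simp only [← fourierBasis_repr, map_neg]
    rfl
  rw [fourierCoeff_negSecondDeriv, h2, hc, fourierCoeff_toLp, neg_mul, neg_neg]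

theorem mulPotential_toL2per (V : C(AddCircle L, ℝ)) (Y : C(AddCircle L, ℂ)) :
    mulPotential V (toL2per Y)
      = toL2per (⟨fun x => (V x : ℂ), Complex.continuous_ofReal.comp V.continuous⟩ * Y) := by
  refine Lp.ext ?_
  filter_upwards [coeFn_mulPotential V (toL2per Y),
    ContinuousMap.coeFn_toLp (p := 2) (𝕜 := ℂ) AddCircle.haarAddCircle Y,
    ContinuousMap.coeFn_toLp (p := 2) (𝕜 := ℂ) AddCircle.haarAddCircle
      (⟨fun x => (V x : ℂ), Complex.continuous_ofReal.comp V.continuous⟩ * Y)] with x h1 h2 h3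
  rw [h1, h3, h2]
  rfl

/-- With `s = 1 + n²`, the bound `|a| ≤ 1/s + s²|a|²` follows from the arithmetic–geometric mean
inequality. -/
theorem summable_fourierCoeff_of_mem {f : L2per L} (hf : f ∈ H2per L) :
    Summable (fourierCoeff f) := by
  have hf : Summable fun n : ℤ => (1 + (n : ℝ) ^ 2) ^ 2 * ‖fourierCoeff f n‖ ^ 2 := hf
  refine Summable.of_norm_bounded (summable_inv_one_add_sq.add hf) fun n => ?_
  have h1 : 1 ≤ 1 + (n : ℝ) ^ 2 := by linarith [sq_nonneg (n : ℝ)]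
  generalize 1 + (n : ℝ) ^ 2 = s at h1 ⊢
  have hs : 0 < s := by linarith
  rw [div_add' _ _ _ hs.ne', le_div_iff₀ hs]
  nlinarith [mul_nonneg (sub_nonneg.2 h1) (sq_nonneg (s * ‖fourierCoeff f n‖)),
    sq_nonneg (s * ‖fourierCoeff f n‖ - 1), norm_nonneg (fourierCoeff f n)]

theorem exists_continuous_of_mem {f : L2per L} (hf : f ∈ H2per L) :
    ∃ Y : C(AddCircle L, ℂ), f = toL2per Y := by
  have hs : Summable fun n : ℤ => fourierCoeff f n • (fourier n : C(AddCircle L, ℂ)) := by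
    refine Summable.of_norm ?_
    simp_rw [norm_smul, fourier_norm, mul_one]
    exact (summable_fourierCoeff_of_mem hf).norm
  refine ⟨∑' n : ℤ, fourierCoeff f n • fourier n, ?_⟩
  have h1 := hs.hasSum.mapL (ContinuousMap.toLp (E := ℂ) 2 AddCircle.haarAddCircle ℂ)
  refine (hasSum_fourier_series_L2 f).unique ?_
  convert! h1 using 2

theorem eq_const_of_fourierCoeff {Z : C(AddCircle L, ℂ)} (h : ∀ n : ℤ, n ≠ 0 → fourierCoeff Z n = 0) :
    ∃ c : ℂ, ∀ x, Z x = c := by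
  refine ⟨fourierCoeff Z 0, fun x => ?_⟩
  have hs : Summable (fourierCoeff Z) :=
    summable_of_ne_finset_zero (s := {0}) fun n hn => h n (by simpa using hn)
  have h1 := has_pointwise_sum_fourier_series_of_summable hs x
  have h2 := h1.unique (hasSum_single 0 fun n hn => by rw [h n hn, zero_smul])
  rw [h2, fourier_zero, smul_eq_mul, mul_one]

theorem mem_eigenspace_of_isPeriodicSolution (V : C(AddCircle L, ℝ)) {lam : ℝ}
    {Y : C(AddCircle L, ℂ)} {y' : ℝ → ℂ}
    (h : IsPeriodicSolution L (fun x => V x) lam (fun x : ℝ => Y x) y') :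
    ∃ hmem : toL2per Y ∈ (hillOperator V).domain,
      (⟨toL2per Y, hmem⟩ : (hillOperator V).domain) ∈ eigenspace (hillOperator V) (lam : ℂ) := by
  let W : C(AddCircle L, ℂ) := ⟨fun x => (V x : ℂ), Complex.continuous_ofReal.comp V.continuous⟩
  obtain ⟨hmem, hD⟩ := negSecondDeriv_of_hasDerivAt (Y := Y)
    (Y' := circleLift y' h.continuous_deriv h.periodic_deriv) (Y'' := W * Y - (lam : ℂ) • Y)
    (fun x => by rw [circleLift_coe]; exact h.hasDerivAt x)
    (fun x => by
      simp only [circleLift_coe]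
      convert! h.hasDerivAt_deriv x using 1
      rw [Complex.real_smul, Complex.ofReal_sub, sub_mul]
      rfl)
  refine ⟨hmem, mem_eigenspace.2 ?_⟩
  rw [hillOperator_apply]
  refine (congrArg₂ (· + ·) hD (mulPotential_toL2per V Y)).trans ?_
  change -toL2per (W * Y - (lam : ℂ) • Y) + toL2per (W * Y) = (lam : ℂ) • toL2per Y
  simp only [toL2per, map_sub, map_smul]
  abel

theorem exists_isPeriodicSolution_of_mem_eigenspace (V : C(AddCircle L, ℝ)) {lam : ℝ}
    {f : (hillOperator V).domain} (hf : f ∈ eigenspace (hillOperator V) (lam : ℂ)) :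
    ∃ (Y : C(AddCircle L, ℂ)) (y' : ℝ → ℂ),
      IsPeriodicSolution L (fun x => V x) lam (fun x : ℝ => Y x) y' ∧ (f : L2per L) = toL2per Y := by
  let W : C(AddCircle L, ℂ) := ⟨fun x => (V x : ℂ), Complex.continuous_ofReal.comp V.continuous⟩
  obtain ⟨Y, hY⟩ := exists_continuous_of_mem (f := (f : L2per L)) f.2
  have hD : negSecondDeriv L f = toL2per ((lam : ℂ) • Y - W * Y) := by
    have h1 := mem_eigenspace.1 hf
    rw [hillOperator_apply, hY, mulPotential_toL2per] at h1
    rw [eq_sub_of_add_eq h1]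
    simp only [toL2per, map_sub, map_smul]
    rfl
  have hc : ∀ n : ℤ, fourierCoeff ((lam : ℂ) • Y - W * Y : C(AddCircle L, ℂ)) n
      = (((2 * Real.pi * n / L) ^ 2 : ℝ) : ℂ) * fourierCoeff Y n := by
    intro n
    have h1 := fourierCoeff_negSecondDeriv f n
    rw [hY, fourierCoeff_toLp] at h1
    rw [← h1, ← fourierCoeff_toLp]
    exact congrArg (fun g : L2per L => fourierCoeff g n) hD.symm
  -- `(lam - V)Y` is integrated twice, to `P` and then `Q`. The Fourier coefficients of `Y + Q`
  -- vanish off `n = 0`, so `Y` is a constant minus `Q`, which is twice differentiable.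
  obtain ⟨P, hP, hP0⟩ := exists_antiderivative (h := (lam : ℂ) • Y - W * Y) (by rw [hc]; simp)
  obtain ⟨Q, hQ, -⟩ := exists_antiderivative hP0
  obtain ⟨c, hcst⟩ := eq_const_of_fourierCoeff (Z := Y + Q) (fun n hn => by
    have h1 := fourierCoeff_of_hasDerivAt hQ n
    have h2 := fourierCoeff_of_hasDerivAt hP n
    rw [hc, h1] at h2
    have hadd : fourierCoeff ((Y + Q : C(AddCircle L, ℂ)) : AddCircle L → ℂ) n
        = fourierCoeff Y n + fourierCoeff Q n := by
      rw [← fourierCoeff_toLp, map_add, fourierCoeff_add_L2per, fourierCoeff_toLp,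
        fourierCoeff_toLp]
    have hne : (((2 * Real.pi * n / L) ^ 2 : ℝ) : ℂ) ≠ 0 := by
      have := hL.out
      have hn' : (n : ℝ) ≠ 0 := by exact_mod_cast hn
      exact_mod_cast (by positivity : (2 * Real.pi * n / L) ^ 2 ≠ 0)
    rw [hadd]
    refine (mul_eq_zero.1 (?_ : (((2 * Real.pi * n / L) ^ 2 : ℝ) : ℂ) * _ = 0)).resolve_left hne
    rw [mul_add, h2]
    push_cast
    linear_combination (4 * Real.pi ^ 2 * n ^ 2 / L ^ 2 : ℂ) * fourierCoeff Q n * Complex.I_sq)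
  refine ⟨Y, fun x => -P x, ⟨periodic_coe_circle Y, fun x => ?_, fun x => ?_⟩, hY⟩
  · have h1 : (fun x : ℝ => Y (x : AddCircle L)) = fun x : ℝ => c - Q x := by
      funext x
      rw [← hcst x, ContinuousMap.add_apply, add_sub_cancel_right]
    rw [h1]
    exact (hQ x).const_sub c
  · convert! (hP x).neg using 1
    rw [Complex.real_smul, Complex.ofReal_sub]
    change _ = -((lam : ℂ) * Y x - (V x : ℂ) * Y x)
    ring

end Regularity

/-! ### Enumeration of discrete sets of real numbers -/

/-- Iterates the successor map of `S` from its minimum; both exist because bounded-above parts of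
`S` are finite. -/
theorem exists_strictMono_enumeration {S : Set ℝ} (hinf : S.Infinite)
    (hfin : ∀ M, (S ∩ Set.Iic M).Finite) :
    ∃ u : ℕ → ℝ, StrictMono u ∧ Tendsto u atTop atTop ∧ Set.range u = S := by
  classical
  have hunb : ∀ M, ∃ x ∈ S, M < x := by
    intro M
    by_contra hc
    push Not at hc
    exact hinf ((hfin M).subset fun x hx => ⟨hx, hc x hx⟩)
  have hnext : ∀ M, ∃ x, (x ∈ S ∧ M < x) ∧ ∀ y ∈ S, M < y → x ≤ y := by
    intro M
    obtain ⟨x₀, hx₀, hM⟩ := hunb M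
    have hf : (S ∩ Set.Ioc M x₀).Finite := (hfin x₀).subset fun x hx => ⟨hx.1, hx.2.2⟩
    obtain ⟨x, hx, hmin⟩ := Set.exists_min_image _ id hf ⟨x₀, hx₀, hM, le_rfl⟩
    refine ⟨x, ⟨hx.1, hx.2.1⟩, fun y hy hMy => ?_⟩
    rcases le_total y x₀ with h | h
    · exact hmin y ⟨hy, hMy, h⟩
    · exact hx.2.2.trans h
  choose next hnext hle using hnext
  obtain ⟨b, hb, hbmin⟩ : ∃ b ∈ S, ∀ y ∈ S, b ≤ y := by
    obtain ⟨x₀, hx₀⟩ := hinf.nonempty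
    obtain ⟨x, hx, hmin⟩ := Set.exists_min_image _ id (hfin x₀) ⟨x₀, hx₀, Set.self_mem_Iic⟩
    refine ⟨x, hx.1, fun y hy => ?_⟩
    rcases le_total y x₀ with h | h
    · exact hmin y ⟨hy, h⟩
    · exact le_trans hx.2 h
  let u : ℕ → ℝ := fun n => next^[n] b
  have hsucc : ∀ n, u (n + 1) = next (u n) := fun n => Function.iterate_succ_apply' next n b
  have hmono : StrictMono u := strictMono_nat_of_lt_succ fun n => by
    rw [hsucc]; exact (hnext _).2
  have hmem : ∀ n, u n ∈ S := by
    intro n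
    cases n with
    | zero => exact hb
    | succ n => rw [hsucc]; exact (hnext _).1
  have hrange : ∀ M, ∃ n, M < u n := by
    intro M
    by_contra hc
    push Not at hc
    exact Set.infinite_range_of_injective hmono.injective
      ((hfin M).subset (by rintro _ ⟨n, rfl⟩; exact ⟨hmem n, hc n⟩))
  refine ⟨u, hmono, tendsto_atTop_atTop_of_monotone hmono.monotone fun M =>
    (hrange M).imp fun n hn => hn.le, Set.Subset.antisymm ?_ fun x hx => ?_⟩
  · rintro _ ⟨n, rfl⟩
    exact hmem n
  · have hex := hrange x
    have hlt := Nat.find_spec hex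
    have hpos : Nat.find hex ≠ 0 := by
      intro h0
      rw [h0] at hlt
      exact absurd (hbmin x hx) (not_le.2 hlt)
    obtain ⟨m, hm⟩ := Nat.exists_eq_succ_of_ne_zero hpos
    have h1 : u m ≤ x := not_lt.1 (Nat.find_min hex (by omega))
    refine ⟨m, h1.antisymm ?_⟩
    by_contra hc
    rw [hm, Nat.succ_eq_add_one, hsucc] at hlt
    exact absurd (hle (u m) x hx (not_le.1 hc)) (not_le.2 hlt)

theorem initial_values {u : ℕ → ℝ} (hu : StrictMono u) {a b c : ℝ} (hab : a < b) (hbc : b < c)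
    (ha : a ∈ Set.range u) (hb : b ∈ Set.range u) (hc : c ∈ Set.range u)
    (h : ∀ n, u n ≤ c → u n = a ∨ u n = b ∨ u n = c) : u 0 = a ∧ u 1 = b ∧ u 2 = c := by
  obtain ⟨i, rfl⟩ := ha
  obtain ⟨j, rfl⟩ := hb
  obtain ⟨k, rfl⟩ := hc
  rw [hu.lt_iff_lt] at hab hbc
  have h' : ∀ n ≤ k, n = i ∨ n = j ∨ n = k := fun n hn => by
    simpa only [hu.injective.eq_iff] using h n (hu.monotone hn)
  have h0 := h' 0 (by omega)
  have h1 := h' 1 (by omega)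
  have h2 := h' 2 (by omega)
  obtain rfl : i = 0 := by omega
  obtain rfl : j = 1 := by omega
  obtain rfl : k = 2 := by omega
  exact ⟨rfl, rfl, rfl⟩

/-! ### Multiplicities of the eigenvalues -/

section Multiplicity

variable {L : ℝ}

/-- A real periodic function as a complex function on the circle. -/
noncomputable def circleOfReal (y : ℝ → ℝ) (hc : Continuous y) (hp : Function.Periodic y L) :
    C(AddCircle L, ℂ) :=
  circleLift (fun x => (y x : ℂ)) (Complex.continuous_ofReal.comp hc) fun x => by
    simp only [hp x]

theorem circleOfReal_coe (y : ℝ → ℝ) (hc : Continuous y) (hp : Function.Periodic y L) (x : ℝ) :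
    circleOfReal y hc hp (x : AddCircle L) = (y x : ℂ) :=
  circleLift_coe _ _ _ x

variable [hL : Fact (0 < L)] {V : C(AddCircle L, ℝ)} {lam : ℝ}

theorem ofReal_mem_eigenspace {y y' : ℝ → ℝ}
    (hy : IsPeriodicSolution L (fun x => V x) lam y y') (hc : Continuous y)
    (hp : Function.Periodic y L) :
    ∃ hmem : toL2per (circleOfReal y hc hp) ∈ (hillOperator V).domain,
      (⟨toL2per (circleOfReal y hc hp), hmem⟩ : (hillOperator V).domain)
        ∈ eigenspace (hillOperator V) (lam : ℂ) := by
  refine mem_eigenspace_of_isPeriodicSolution V (y' := fun x => (y' x : ℂ)) ?_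
  have := hy.map Complex.ofRealCLM
  simp only [circleOfReal_coe]
  exact this

theorem eigenspace_eq_span_singleton {y y' : ℝ → ℝ}
    (hy : IsPeriodicSolution L (fun x => V x) lam y y') (hc : Continuous y)
    (hp : Function.Periodic y L)
    (hall : ∀ f f' : ℝ → ℝ, IsPeriodicSolution L (fun x => V x) lam f f' →
      ∃ c : ℝ, ∀ x, f x = c * y x) :
    ∃ hmem : toL2per (circleOfReal y hc hp) ∈ (hillOperator V).domain,
      eigenspace (hillOperator V) (lam : ℂ)
        = Submodule.span ℂ {⟨toL2per (circleOfReal y hc hp), hmem⟩} := by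
  obtain ⟨hmem, hme⟩ := ofReal_mem_eigenspace hy hc hp
  refine ⟨hmem, le_antisymm (fun f hf => ?_) ?_⟩
  · obtain ⟨Y, y', hY, hfY⟩ := exists_isPeriodicSolution_of_mem_eigenspace V hf
    -- Since `V` and `lam` are real, real and imaginary parts solve the same equation.
    obtain ⟨a, ha⟩ := hall _ _ (hY.map Complex.reCLM)
    obtain ⟨b, hb⟩ := hall _ _ (hY.map Complex.imCLM)
    refine Submodule.mem_span_singleton.2 ⟨a + b * Complex.I, Subtype.ext ?_⟩
    rw [hfY]
    change ((a : ℂ) + b * Complex.I) • toL2per (circleOfReal y hc hp) = _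
    rw [toL2per, ← map_smul]
    congr 1
    refine circle_ext fun x => ?_
    have h1 : (Y x).re = a * y x := ha x
    have h2 : (Y x).im = b * y x := hb x
    rw [ContinuousMap.smul_apply, circleOfReal_coe, smul_eq_mul]
    apply Complex.ext <;> simp [h1, h2]
  · rw [Submodule.span_singleton_le_iff_mem]
    exact hme

theorem finrank_eigenspace_eq_one {y y' : ℝ → ℝ}
    (hy : IsPeriodicSolution L (fun x => V x) lam y y') {x₀ : ℝ} (hne : y x₀ ≠ 0)
    (hall : ∀ f f' : ℝ → ℝ, IsPeriodicSolution L (fun x => V x) lam f f' →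
      ∃ c : ℝ, ∀ x, f x = c * y x) :
    Module.finrank ℂ (eigenspace (hillOperator V) (lam : ℂ)) = 1 := by
  obtain ⟨hmem, h⟩ := eigenspace_eq_span_singleton hy hy.continuous hy.periodic hall
  rw [h]
  refine finrank_span_singleton fun h0 => hne ?_
  have h1 : toL2per (circleOfReal y hy.continuous hy.periodic) = toL2per 0 :=
    (congrArg Subtype.val h0).trans (map_zero _).symm
  have h2 := congrArg (fun F : C(AddCircle L, ℂ) => F (x₀ : AddCircle L)) (toL2per_injective h1)
  simp only [circleOfReal_coe, ContinuousMap.zero_apply] at h2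
  exact_mod_cast h2

theorem exists_real_solution (hne : eigenspace (hillOperator V) (lam : ℂ) ≠ ⊥) :
    ∃ f f' : ℝ → ℝ, IsPeriodicSolution L (fun x => V x) lam f f' ∧ ∃ x, f x ≠ 0 := by
  obtain ⟨f, hf, hf0⟩ := Submodule.exists_mem_ne_zero_of_ne_bot hne
  obtain ⟨Y, y', hY, hfY⟩ := exists_isPeriodicSolution_of_mem_eigenspace V hf
  by_contra hc
  push Not at hc
  have h1 := hc _ _ (hY.map Complex.reCLM)
  have h2 := hc _ _ (hY.map Complex.imCLM)
  have h3 : Y = 0 := circle_ext fun x => Complex.ext (h1 x) (h2 x)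
  refine hf0 (Subtype.ext ?_)
  rw [hfY, h3]
  exact map_zero _

theorem finrank_eigenspace_eq_two {y y' w w' : ℝ → ℝ}
    (hy : IsPeriodicSolution L (fun x => V x) lam y y')
    (hw : IsPeriodicSolution L (fun x => V x) lam w w') {x₀ : ℝ}
    (hW : y x₀ * w' x₀ - y' x₀ * w x₀ ≠ 0) :
    Module.finrank ℂ (eigenspace (hillOperator V) (lam : ℂ)) = 2 := by
  obtain ⟨hmy, hey⟩ := ofReal_mem_eigenspace hy hy.continuous hy.periodic
  obtain ⟨hmw, hew⟩ := ofReal_mem_eigenspace hw hw.continuous hw.periodic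
  have hspan : eigenspace (hillOperator V) (lam : ℂ) = Submodule.span ℂ (Set.range
      ![(⟨_, hmy⟩ : (hillOperator V).domain), ⟨_, hmw⟩]) := by
    rw [Matrix.range_cons, Matrix.range_cons, Matrix.range_empty, Set.union_empty,
      Set.singleton_union]
    refine le_antisymm (fun f hf => ?_) ?_
    · obtain ⟨Y, Y', hY, hfY⟩ := exists_isPeriodicSolution_of_mem_eigenspace V hf
      obtain ⟨a, b, hab⟩ := hY.eq_combination hy hw (C := ‖V‖)
        (fun x => by rw [← Real.norm_eq_abs]; exact V.norm_coe_le_norm _) hW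
      refine Submodule.mem_span_pair.2 ⟨a, b, Subtype.ext ?_⟩
      rw [hfY]
      change a • toL2per (circleOfReal y hy.continuous hy.periodic)
        + b • toL2per (circleOfReal w hw.continuous hw.periodic) = _
      rw [toL2per, toL2per, ← map_smul, ← map_smul, ← map_add]
      congr 1
      refine circle_ext fun x => ?_
      rw [hab x]
      simp only [ContinuousMap.add_apply, ContinuousMap.smul_apply, circleOfReal_coe, smul_eq_mul,
        Complex.real_smul]
      ring
    · rw [Submodule.span_le]
      rintro _ (rfl | rfl)
      · exact hey
      · exact hew
  rw [hspan, finrank_span_eq_card, Fintype.card_fin]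
  refine LinearIndependent.pair_iff.2 fun s t hst => ?_
  have h1 : toL2per (s • circleOfReal y hy.continuous hy.periodic
      + t • circleOfReal w hw.continuous hw.periodic) = toL2per 0 := by
    rw [toL2per, toL2per, map_add, map_smul, map_smul, map_zero]
    exact congrArg Subtype.val hst
  have h2 : ∀ x : ℝ, s * y x + t * w x = 0 := fun x => by
    have := congrArg (fun F : C(AddCircle L, ℂ) => F (x : AddCircle L)) (toL2per_injective h1)
    simpa only [ContinuousMap.add_apply, ContinuousMap.smul_apply, circleOfReal_coe, smul_eq_mul,
      ContinuousMap.zero_apply] using this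
  -- Differentiating the linear relation gives a second equation at `x₀`; the determinant of the
  -- system is the Wronskian.
  have h3 : s * y' x₀ + t * w' x₀ = 0 := by
    have hd := ((hy.hasDerivAt x₀).ofReal_comp.const_mul s).add
      ((hw.hasDerivAt x₀).ofReal_comp.const_mul t)
    have h0 : ((fun x => s * (y x : ℂ)) + fun x => t * (w x : ℂ)) = fun _ => 0 := funext h2
    rw [h0] at hd
    exact hd.unique (hasDerivAt_const x₀ 0)
  have hWc : ((y x₀ * w' x₀ - y' x₀ * w x₀ : ℝ) : ℂ) ≠ 0 := by exact_mod_cast hW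
  push_cast at hWc
  constructor
  · refine (mul_eq_zero.1 (?_ : s * _ = 0)).resolve_right hWc
    linear_combination (w' x₀ : ℂ) * h2 x₀ - (w x₀ : ℂ) * h3
  · refine (mul_eq_zero.1 (?_ : t * _ = 0)).resolve_right hWc
    linear_combination (y x₀ : ℂ) * h3 - (y' x₀ : ℂ) * h2 x₀

end Multiplicity

/-! ### The spectrum of the Hill operator of a dnoidal profile -/

theorem IsDnoidalProfile.spectrum_hillOperator {L e₁ e₂ : ℝ} [Fact (0 < L)] {q q' : ℝ → ℝ}
    (h : IsDnoidalProfile L e₁ e₂ q q') {V : C(AddCircle L, ℝ)}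
    (hV : (fun x : ℝ => V (x : AddCircle L)) = profilePotential e₁ e₂ q) :
    ∃ lam : ℕ → ℝ, StrictMono lam ∧ Tendsto lam atTop atTop ∧
      PeriodicHill.spectrum (hillOperator V) = Set.range (fun n => (lam n : ℂ)) ∧
      Module.finrank ℂ (eigenspace (hillOperator V) (lam 0 : ℂ)) = 1 ∧
      Module.finrank ℂ (eigenspace (hillOperator V) (lam 1 : ℂ)) = 1 ∧
      Module.finrank ℂ (eigenspace (hillOperator V) (lam 2 : ℂ)) = 1 ∧
      (∀ n, 3 ≤ n → Module.finrank ℂ (eigenspace (hillOperator V) (lam n : ℂ)) = 2) ∧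
      lam 0 < 0 ∧ lam 1 = 0 := by
  have hD := h.edgeRoot_pos
  have hlt2 := h.lt_two_mul_edgeRoot
  have hsum : 0 < e₁ + e₂ := add_pos h.e₁_pos h.e₂_pos
  have hcl := fun {lam : ℝ} (hl : lam ≤ -(e₁ + e₂) + 2 * edgeRoot e₁ e₂) {f f' : ℝ → ℝ}
    (hf : IsPeriodicSolution L (fun x : ℝ => V x) lam f f') => h.eq_of_le hl (hV ▸ hf)
  have hlow := h.isPeriodicSolution_lower
  have hder := h.isPeriodicSolution_deriv
  have hup := h.isPeriodicSolution_upper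
  rw [← hV] at hlow hder hup
  obtain ⟨z, -, hqz⟩ := h.exists_sq_eq h.lt_upper h.upper_lt
  have hq'z : q' z ≠ 0 :=
    h.deriv_ne_zero (by rw [hqz]; exact h.lt_upper) (by rw [hqz]; exact h.upper_lt)
  have hl0 := h.lower_lt
  have hu1 := h.upper_lt
  have hlt := h.lt
  set a := -(e₁ + e₂) - 2 * edgeRoot e₁ e₂ with ha
  set b := -(e₁ + e₂) + 2 * edgeRoot e₁ e₂ with hb
  have hab : a < b := by linarith
  have ha0 : a < 0 := by linarith
  have h0b : 0 < b := by linarith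
  have f0 : Module.finrank ℂ (eigenspace (hillOperator V) (a : ℂ)) = 1 := by
    refine finrank_eigenspace_eq_one hlow (x₀ := 0)
      (by rw [h.sq_zero]; intro hc; linarith) fun f f' hf => ?_
    rcases hcl hab.le hf with h1 | ⟨-, h1⟩ | ⟨h1, -⟩ | ⟨h1, -⟩
    · exact ⟨0, fun x => by rw [h1, zero_mul]⟩
    · exact h1
    · exact absurd h1 ha0.ne
    · exact absurd h1 hab.ne
  have f1 : Module.finrank ℂ (eigenspace (hillOperator V) ((0 : ℝ) : ℂ)) = 1 := by
    refine finrank_eigenspace_eq_one hder hq'z fun f f' hf => ?_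
    rcases hcl h0b.le hf with h1 | ⟨h1, -⟩ | ⟨-, h1⟩ | ⟨h1, -⟩
    · exact ⟨0, fun x => by rw [h1, zero_mul]⟩
    · exact absurd h1 ha0.ne'
    · exact h1
    · exact absurd h1 h0b.ne
  have f2 : Module.finrank ℂ (eigenspace (hillOperator V) (b : ℂ)) = 1 := by
    refine finrank_eigenspace_eq_one hup (x₀ := 0)
      (by rw [h.sq_zero]; intro hc; linarith) fun f f' hf => ?_
    rcases hcl le_rfl hf with h1 | ⟨h1, -⟩ | ⟨h1, -⟩ | ⟨-, h1⟩
    · exact ⟨0, fun x => by rw [h1, zero_mul]⟩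
    · exact absurd h1 hab.ne'
    · exact absurd h1 h0b.ne'
    · exact h1
  have hbelow : ∀ t : ℝ, eigenspace (hillOperator V) (t : ℂ) ≠ ⊥ → t ≤ b →
      t = a ∨ t = 0 ∨ t = b := by
    intro t ht htb
    obtain ⟨f, f', hf, x, hx⟩ := exists_real_solution ht
    rcases hcl htb hf with h1 | ⟨h1, -⟩ | ⟨h1, -⟩ | ⟨h1, -⟩
    · exact absurd (h1 x) hx
    · exact Or.inl h1
    · exact Or.inr (Or.inl h1)
    · exact Or.inr (Or.inr h1)
  have habove : ∀ t : ℝ, eigenspace (hillOperator V) (t : ℂ) ≠ ⊥ → b < t →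
      Module.finrank ℂ (eigenspace (hillOperator V) (t : ℂ)) = 2 := by
    intro t ht htb
    obtain ⟨f, f', hf, x, hx⟩ := exists_real_solution ht
    obtain ⟨g, g', hg, hW⟩ := h.exists_second_solution htb (hV ▸ hf) hx
    exact finrank_eigenspace_eq_two hf (hV.symm ▸ hg) hW
  have hge : ∀ t : ℝ, eigenspace (hillOperator V) (t : ℂ) ≠ ⊥ → a ≤ t := by
    intro t ht
    rcases le_or_gt t b with htb | htb
    · rcases hbelow t ht htb with h1 | h1 | h1 <;> linarith
    · linarith
  -- All eigenvalues are at least `a`, so `a - 1` is a real resolvent point below them.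
  have hbot : eigenspace (hillOperator V) ((a - 1 : ℝ) : ℂ) = ⊥ := by
    by_contra hc
    linarith [hge _ hc]
  obtain ⟨A, hAc, hA⟩ := exists_isResolvent V hbot
  obtain ⟨hinf, hfin⟩ := infinite_and_finite_eigenvalues not_finiteDimensional_L2per
    (hillOperator_symmetric V) hA hAc fun t ht => by linarith [hge t ht]
  obtain ⟨lam, hmono, htend, hrange⟩ := exists_strictMono_enumeration hinf hfin
  have hmem : ∀ t : ℝ, t ∈ Set.range lam ↔ eigenspace (hillOperator V) (t : ℂ) ≠ ⊥ := fun t => by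
    rw [hrange]; rfl
  have hone : ∀ t : ℝ, Module.finrank ℂ (eigenspace (hillOperator V) (t : ℂ)) = 1 →
      t ∈ Set.range lam := fun t ht => by
    rw [hmem]
    intro h1
    rw [h1, finrank_bot] at ht
    exact zero_ne_one ht
  obtain ⟨l0, l1, l2⟩ := initial_values hmono ha0 h0b (hone _ f0) (hone _ f1) (hone _ f2)
    fun n hn => hbelow _ ((hmem _).1 ⟨n, rfl⟩) hn
  refine ⟨lam, hmono, htend, ?_, by rw [l0]; exact f0, by rw [l1]; exact f1, by rw [l2]; exact f2,
    fun n hn => ?_, by rw [l0]; exact ha0, l1⟩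
  · ext z
    rw [mem_spectrum_hillOperator]
    constructor
    · intro hz
      have him := eigenvalue_im_eq_zero (hillOperator_symmetric V) hz
      have hre : (z.re : ℂ) = z := Complex.ext rfl him.symm
      rw [← hre] at hz
      obtain ⟨n, hn⟩ := (hmem _).2 hz
      exact ⟨n, by simp only [hn, hre]⟩
    · rintro ⟨n, rfl⟩
      exact (hmem _).1 ⟨n, rfl⟩
  · refine habove _ ((hmem _).1 ⟨n, rfl⟩) ?_
    rw [← l2]
    exact hmono (by omega)

theorem IsDnoidalProfile.eigenspace_zero {L e₁ e₂ : ℝ} [Fact (0 < L)] {q q' : ℝ → ℝ}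
    (h : IsDnoidalProfile L e₁ e₂ q q') {V : C(AddCircle L, ℝ)}
    (hV : (fun x : ℝ => V (x : AddCircle L)) = profilePotential e₁ e₂ q) {r : ℝ} (hr : r ≠ 0)
    (hc : Continuous fun x => r * q' x) (hp : Function.Periodic (fun x => r * q' x) L) :
    ∃ hmem : toL2per (circleOfReal (fun x => r * q' x) hc hp) ∈ (hillOperator V).domain,
      eigenspace (hillOperator V) 0
        = Submodule.span ℂ {⟨toL2per (circleOfReal (fun x => r * q' x) hc hp), hmem⟩} := by
  have hD := h.edgeRoot_pos
  have hlt2 := h.lt_two_mul_edgeRoot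
  have hsum : 0 < e₁ + e₂ := add_pos h.e₁_pos h.e₂_pos
  have hder := h.isPeriodicSolution_deriv.const_smul r
  rw [← hV] at hder
  have := eigenspace_eq_span_singleton hder hc hp fun f f' hf => by
    rcases h.eq_of_le (by linarith) (hV ▸ hf) with h1 | ⟨h1, -⟩ | ⟨-, d, h1⟩ | ⟨h1, -⟩
    · exact ⟨0, fun x => by rw [h1, zero_mul]⟩
    · linarith
    · refine ⟨d / r, fun x => ?_⟩
      rw [h1, smul_eq_mul]
      field_simp
    · linarith
  rw [Complex.ofReal_zero] at this
  exact this

end PeriodicHill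

/-! ### Reduction of the dnoidal wave to the normalized profile -/

open PeriodicHill in
theorem theorem6 (L c σ η₁ η₂ : ℝ) [Fact (0 < L)] (hc : 0 < c)
    (hσ : 2 * Real.pi ^ 2 / L ^ 2 < σ)
    (hη₂ : 0 < η₂) (hη : η₂ < η₁) (hησ : η₁ ^ 2 + η₂ ^ 2 = 4 * c * σ)
    (hL : 4 * √c / η₁ * ellipticK (modulus η₁ η₂) = L) :
    -- the potential `σ - 3 φ₀² / (2c)` is a continuous function on the circle of length `L`
    ∃ V : C(AddCircle L, ℝ),
      (∀ x : ℝ, V (x : AddCircle L) = σ - 3 / (2 * c) * dnoidal c η₁ η₂ x ^ 2) ∧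
    -- `φ₀` is differentiable, and its derivative is a continuous function on the circle
    ∃ φ' : C(AddCircle L, ℂ),
      (∀ x : ℝ, ∃ d : ℝ, HasDerivAt (dnoidal c η₁ η₂) d x ∧ φ' (x : AddCircle L) = (d : ℂ)) ∧
    -- `lam` lists the distinct eigenvalues in increasing order
    ∃ lam : ℕ → ℝ, StrictMono lam ∧ Tendsto lam atTop atTop ∧
      PeriodicHill.spectrum (hillOperator V) = Set.range (fun n => (lam n : ℂ)) ∧
      Module.finrank ℂ (eigenspace (hillOperator V) (lam 0 : ℂ)) = 1 ∧
      Module.finrank ℂ (eigenspace (hillOperator V) (lam 1 : ℂ)) = 1 ∧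
      Module.finrank ℂ (eigenspace (hillOperator V) (lam 2 : ℂ)) = 1 ∧
      (∀ n, 3 ≤ n → Module.finrank ℂ (eigenspace (hillOperator V) (lam n : ℂ)) = 2) ∧
      lam 0 < 0 ∧ lam 1 = 0 ∧
      ∃ h : ContinuousMap.toLp 2 AddCircle.haarAddCircle ℂ φ' ∈ (hillOperator V).domain,
        eigenspace (hillOperator V) 0 =
          Submodule.span ℂ {⟨ContinuousMap.toLp 2 AddCircle.haarAddCircle ℂ φ', h⟩} := by
  have hL0 : 0 < L := Fact.out
  have hη₁ : 0 < η₁ := hη₂.trans hη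
  have hsc : 0 < √c := Real.sqrt_pos.2 hc
  have hsq : √c ^ 2 = c := Real.sq_sqrt hc.le
  set k := modulus η₁ η₂ with hk
  have hlt : η₂ ^ 2 < η₁ ^ 2 := by gcongr
  have hk2 : k ^ 2 = (η₁ ^ 2 - η₂ ^ 2) / η₁ ^ 2 :=
    Real.sq_sqrt (div_nonneg (by linarith) (sq_nonneg _))
  have hk1 : k ^ 2 < 1 := by
    rw [hk2, div_lt_one (by positivity)]
    linarith [pow_pos hη₂ 2]
  have hk0 : k ≠ 0 := by
    intro h0
    rw [h0, eq_comm, zero_pow two_ne_zero, div_eq_zero_iff] at hk2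
    rcases hk2 with h1 | h1
    · linarith
    · exact hη₁.ne' (pow_eq_zero_iff two_ne_zero |>.1 h1)
  have hK : 0 < ellipticK k := by
    rw [← hL] at hL0
    exact pos_of_mul_pos_right hL0 (by positivity)
  -- The scale `η₁ / (2√c)` gives `φ₀ = 2√c q`, so `3φ₀² / (2c) = 6q²`.
  have hprof := isDnoidalProfile_dn hk1 hk0 (a := η₁ / (2 * √c)) (by positivity) hK
  have hper : 2 * ellipticK k / (η₁ / (2 * √c)) = L := by
    rw [← hL]
    field_simp
    ring
  rw [hper] at hprof
  set a := η₁ / (2 * √c) with ha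
  have hη₁a : η₁ = 2 * √c * a := by rw [ha]; field_simp
  have ha2 : a ^ 2 = η₁ ^ 2 / (4 * c) := by
    rw [ha, div_pow, mul_pow, hsq]; norm_num
  -- Here `e₁ = η₁² / (4c)` and `e₂ = η₂² / (4c)`, so the relation between `η₁`, `η₂` and `σ` says
  -- exactly `e₁ + e₂ = σ`.
  have hσe : a ^ 2 + a ^ 2 * (1 - k ^ 2) = σ := by
    rw [ha2, hk2]
    field_simp
    linarith
  set q : ℝ → ℝ := fun x => a * jacobiDn k (a * x) with hq
  set q' : ℝ → ℝ := fun x => a ^ 2 *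
    (-k ^ 2 * (Real.sin (jacobiAm k (a * x)) * Real.cos (jacobiAm k (a * x)))) with hq'
  have hφ : dnoidal c η₁ η₂ = fun x => 2 * √c * q x := by
    funext x
    change η₁ * jacobiDn k (a * x) = 2 * √c * (a * jacobiDn k (a * x))
    rw [hη₁a]; ring
  let V : C(AddCircle L, ℝ) := circleLift (profilePotential (a ^ 2) (a ^ 2 * (1 - k ^ 2)) q)
    hprof.continuous_potential fun x => by simp only [profilePotential, hprof.periodic x]
  have hV : (fun x : ℝ => V (x : AddCircle L))
      = profilePotential (a ^ 2) (a ^ 2 * (1 - k ^ 2)) q := funext fun x => circleLift_coe _ _ _ x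
  have hr : 2 * √c ≠ 0 := by positivity
  have hc' : Continuous fun x => 2 * √c * q' x := continuous_const.mul hprof.continuous_deriv
  have hp' : Function.Periodic (fun x => 2 * √c * q' x) L := fun x => by
    simp only [hprof.periodic_deriv x]
  refine ⟨V, fun x => ?_, circleOfReal (fun x => 2 * √c * q' x) hc' hp',
    fun x => ⟨2 * √c * q' x, ?_, circleOfReal_coe _ _ _ x⟩, ?_⟩
  · refine (congrFun hV x).trans ?_
    simp only [profilePotential, hσe, hφ, mul_pow, hsq]
    field_simp
    ring
  · rw [hφ]
    exact (hprof.hasDerivAt x).const_mul _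
  · obtain ⟨lam, h1, h2, h3, h4, h5, h6, h7, h8, h9⟩ := hprof.spectrum_hillOperator hV
    exact ⟨lam, h1, h2, h3, h4, h5, h6, h7, h8, h9, hprof.eigenspace_zero hV hr hc' hp'⟩
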